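/- Let $\mathbf k$ be an algebraically closed field of characteristic $p>0$, and let $\mathcal C$ be a symmetric tensor category over $\mathbf k$: a locally finite $\mathbf k$-linear abelian rigid symmetric monoidal category (all spaces $\mathrm{Hom}(X,Y)$ are finite-dimensional over $\mathbf k$ and every object has finite length) whose tensor product is $\mathbf k$-bilinear on morphisms and with $\mathrm{End}(\mathbf 1)=\mathbf k$. For $X\in\mathcal C$ with dual $X^*$ let $\dim(X)\in\mathrm{End}(\mathbf 1)=\mathbf k$ be its categorical dimension, i.e. the composition of the coevaluation $\mathbf 1\to X\otimes X^*$, the symmetry $c_{X,X^*}:X\otimes X^*\to X^*\otimes X$ and the evaluation $X^*\otimes X\to\mathbf 1$. For $1\le i\le n-1$ let $c_i$ be the automorphism of $X^{\otimes n}$ given by the symmetry $c_{X,X}$ of the $i$-th and $(i+1)$-st factors. Put $$\mathbb S^nX:=\bigcap_{i=1}^{n-1}\mathrm{Ker}(c_i-1)\subset X^{\otimes n},\qquad \Lambda^nX:=\bigcap_{i=1}^{n-1}\mathrm{Im}(c_i-1)\subset X^{\otimes n}$$ (the empty intersection is $X^{\otimes n}$, so $\mathbb S^0X=\Lambda^0X=\mathbf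 1$ and $\mathbb S^1X=\Lambda^1X=X$). For a $p$-adic integer $t=\sum_{j\ge0}t_jp^j$ with digits $t_j\in\{0,\dots,p-1\}$ put $$(1+z)^t:=\prod_{j\ge 0}\bigl(1+z^{p^j}\bigr)^{t_j}\in\mathbb F_p[[z]]\subset\mathbf k[[z]],$$ and let $(1-z)^t$ be the series obtained from $(1+z)^t$ by substituting $-z$ for $z$. **Theorem.** Let $X\in\mathcal C$. (i) There exists a unique $d_+=d_+(X)\in\mathbb Z_p$ such that $\displaystyle\sum_{j\ge0}\dim(\mathbb S^jX)\,z^j=(1-z)^{-d_+}$ in $\mathbf k[[z]]$. (ii) There exists a unique $d_-=d_-(X)\in\mathbb Z_p$ such that $\displaystyle\sum_{j\ge0}\dim(\Lambda^jX)\,z^j=(1+z)^{d_-}$ in $\mathbf k[[z]]$. Consequently $\mathrm{Dim}_+(X):=d_+(X^*)$ and $\mathrm{Dim}_-(X):=d_-(X^*)$ are well-defined $p$-adic integers, and the reduction modulo $p$ of each of them, viewed in $\mathbb F_p\subset\mathbf k$, equals $\dim(X)$. -/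

import Mathlib

open CategoryTheory MonoidalCategory CategoryTheory.Limits

noncomputable section

namespace PadicDimension

universe u v w

section TensorCategory

/-- The finiteness conditions that make a `k`-linear abelian rigid symmetric monoidal category
with `k`-bilinear tensor product (all of this is given by the instance arguments) into a
symmetric tensor category over `k`: it is locally finite (finite-dimensional spaces of morphisms,
and every object has finite length), and the scalars are all the endomorphisms of the unit
object, `End(𝟙) = k`. -/
class IsSymmetricTensorCategory (k : Type w) [Field k] (C : Type u) [Category.{v} C] [Abelian C]
    [Linear k C] [MonoidalCategory C] [MonoidalPreadditive C] [MonoidalLinear k C]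
    [SymmetricCategory C] [RigidCategory C] : Prop where
  /-- The spaces of morphisms are finite-dimensional. -/
  finiteDimensional_hom : ∀ X Y : C, FiniteDimensional k (X ⟶ Y)
  /-- Objects have finite length (ascending chains). -/
  isNoetherianObject : ∀ X : C, IsNoetherianObject X
  /-- Objects have finite length (descending chains). -/
  isArtinianObject : ∀ X : C, IsArtinianObject X
  /-- `End(𝟙) = k`. -/
  end_unit : Function.Bijective (fun a : k => a • 𝟙 (𝟙_ C))

variable (k : Type w) [Field k] {C : Type u} [Category.{v} C] [Abelian C]
    [Linear k C] [MonoidalCategory C] [MonoidalPreadditive C] [MonoidalLinear k C]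
    [SymmetricCategory C] [RigidCategory C]

/-- The scalar in `k` that corresponds to an endomorphism of the unit object. -/
def unitScalar [IsSymmetricTensorCategory k C] (f : 𝟙_ C ⟶ 𝟙_ C) : k :=
  (Equiv.ofBijective (fun a : k => a • 𝟙 (𝟙_ C)) IsSymmetricTensorCategory.end_unit).symm f

/-- The trace `ev ∘ c_{X,X*} ∘ (A ⊗ 1) ∘ coev` of an endomorphism `A` of `X`. Here `Xᘁ` is the
dual object `X*`, with `coev : 𝟙 ⟶ X ⊗ X*` and `ev : X* ⊗ X ⟶ 𝟙`. -/
def tr [IsSymmetricTensorCategory k C] {X : C} (A : X ⟶ X) : k :=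
  unitScalar k (η_ X Xᘁ ≫ A ▷ Xᘁ ≫ (β_ X Xᘁ).hom ≫ ε_ X Xᘁ)

/-- The categorical dimension `dim X = Tr_X(1)`. -/
def catDim [IsSymmetricTensorCategory k C] (X : C) : k :=
  tr k (𝟙 X)

end TensorCategory

section Powers

variable {C : Type u} [Category.{v} C] [Abelian C] [MonoidalCategory C] [SymmetricCategory C]

/-- The tensor power `X^{⊗ n}`, bracketed to the left. -/
def tensorPow (X : C) : ℕ → C
  | 0 => 𝟙_ C
  | n + 1 => tensorPow X n ⊗ X

/-- The `n` commutativity constraints of adjacent factors of `X^{⊗ (n+1)}`. They are numbered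
from the right: `adjSwap X n 0` exchanges the last two factors, and `adjSwap X n (n-1)` the first
two. -/
def adjSwap (X : C) : (n : ℕ) → Fin n → (tensorPow X (n + 1) ⟶ tensorPow X (n + 1))
  | n + 1, i =>
    Fin.cases (motive := fun _ => (tensorPow X (n + 2) ⟶ tensorPow X (n + 2)))
      ((α_ (tensorPow X n) X X).hom ≫ tensorPow X n ◁ (β_ X X).hom ≫
        (α_ (tensorPow X n) X X).inv)
      (fun j => adjSwap X n j ▷ X) i

/-- The dual symmetric power `𝕊ⁿ X`: the subobject of `Sₙ`-invariants of `X^{⊗ n}`, that is, the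
intersection of the kernels of `c - 1` for all exchanges `c` of adjacent factors. -/
def dualSymPow (X : C) : (n : ℕ) → Subobject (tensorPow X n)
  | 0 => ⊤
  | n + 1 => Finset.univ.inf fun i : Fin n =>
      kernelSubobject (adjSwap X n i - 𝟙 (tensorPow X (n + 1)))

/-- The dual exterior power `Λⁿ X`: the subobject of `X^{⊗ n}` that is the intersection of the
images of `c - 1` for all exchanges `c` of adjacent factors. -/
def dualExtPow (X : C) : (n : ℕ) → Subobject (tensorPow X n)
  | 0 => ⊤
  | n + 1 => Finset.univ.inf fun i : Fin n =>
      imageSubobject (adjSwap X n i - 𝟙 (tensorPow X (n + 1)))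

end Powers

section BinomialSeries

open PowerSeries

variable (k : Type w) [CommRing k] {p : ℕ} [Fact p.Prime]

/-- The digit `t_j ∈ {0, …, p-1}` of the `p`-adic integer `t = ∑_j t_j p^j`. (The number
`t.appr (j+1)` is the representative of `t` modulo `p^(j+1)` between `0` and `p^(j+1) - 1`.) -/
def digit (t : ℤ_[p]) (j : ℕ) : ℕ := t.appr (j + 1) / p ^ j

/-- The power series `(1 + z)^t = ∏_{j ≥ 0} (1 + z^{p^j})^{t_j}` of a `p`-adic integer `t`
(over rings of characteristic `p`). The coefficient of `z^n` in the infinite product is the one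
in the product of the factors with `j ≤ n`, see `coeff_onePlusPow`. -/
def onePlusPow (t : ℤ_[p]) : k⟦X⟧ :=
  PowerSeries.mk fun n =>
    coeff n (∏ j ∈ Finset.range (n + 1), (1 + (X : k⟦X⟧) ^ p ^ j) ^ digit t j)

/-- The coefficients of the partial products of `∏_j (1 + z^{p^j})^{t_j}` are eventually those of
`onePlusPow k t`. -/
theorem coeff_onePlusPow (t : ℤ_[p]) (n N : ℕ) (h : n + 1 ≤ N) :
    coeff n (onePlusPow k t) =
      coeff n (∏ j ∈ Finset.range N, (1 + (X : k⟦X⟧) ^ p ^ j) ^ digit t j) := by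
  induction N, h using Nat.le_induction with
  | base => simp [onePlusPow]
  | succ N hN ih =>
    rw [Finset.prod_range_succ, ih]
    have hlt : n < p ^ N :=
      lt_of_lt_of_le hN (Nat.lt_pow_self (Fact.out : p.Prime).one_lt).le
    have hd : (X : k⟦X⟧) ^ p ^ N ∣ (1 + X ^ p ^ N) ^ digit t N - 1 := by
      have := sub_one_dvd_pow_sub_one (1 + (X : k⟦X⟧) ^ p ^ N) (digit t N)
      simpa using this
    obtain ⟨g, hg⟩ := hd
    rw [sub_eq_iff_eq_add.mp hg, mul_add, mul_one, map_add, mul_left_comm,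
      coeff_X_pow_mul', if_neg (by omega), zero_add]

/-- The power series `(1 - z)^t`: substitute `-z` for `z` in `(1 + z)^t`. -/
def oneSubPow (t : ℤ_[p]) : k⟦X⟧ := rescale (-1) (onePlusPow k t)

end BinomialSeries

section Dimensions

variable (k : Type w) [Field k] {p : ℕ} [Fact p.Prime] {C : Type u} [Category.{v} C] [Abelian C]
    [Linear k C] [MonoidalCategory C] [MonoidalPreadditive C] [MonoidalLinear k C]
    [SymmetricCategory C] [RigidCategory C] [IsSymmetricTensorCategory k C]

/-- The identity `∑_j dim(𝕊ʲ X) z^j = (1 - z)^{-d}` in `k⟦z⟧`, which characterizes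
`d = d₊(X)`. -/
def IsDPlus (X : C) (d : ℤ_[p]) : Prop :=
  PowerSeries.mk (fun j => catDim k (dualSymPow X j : C)) = oneSubPow k (-d)

/-- The identity `∑_j dim(Λʲ X) z^j = (1 + z)^d` in `k⟦z⟧`, which characterizes `d = d₋(X)`. -/
def IsDMinus (X : C) (d : ℤ_[p]) : Prop :=
  PowerSeries.mk (fun j => catDim k (dualExtPow X j : C)) = onePlusPow k d

/-- `D` is the symmetric `p`-adic dimension `Dim₊(X) = d₊(X*)`. -/
def IsSymPadicDim (X : C) (D : ℤ_[p]) : Prop := IsDPlus k Xᘁ D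

/-- `D` is the exterior `p`-adic dimension `Dim₋(X) = d₋(X*)`. -/
def IsExtPadicDim (X : C) (D : ℤ_[p]) : Prop := IsDMinus k Xᘁ D

end Dimensions

end PadicDimension

end

/-!
Let `Pₙ` be either `𝕊ⁿ X` (sign `e = 1`) or `Λⁿ X` (sign `e = -1`), and let `aₙ` be its dimension.
Removing the last letter gives an inclusion `δ : Pₙ₊₁ ⟶ Pₙ ⊗ X`, and `Pₙ₊₂` is the part of
`Pₙ₊₁ ⊗ X` that is (skew-)symmetric in the last two letters; `PowerSystem` axiomatizes this. By
recursion on the last letter one gets the shuffle product `μ : P_r ⊗ P_i ⟶ Pₙ` and the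
deconcatenation `Δ : Pₙ ⟶ P_r ⊗ P_i`, `n = r + i`, and `μ ∘ Δ` is multiplication by the binomial
coefficient `C(n, i)` (`PowerSystem.comul_mul`).

The key point is that the partial trace of `Δ ∘ μ` over `P_r`, an endomorphism of `P_i`, is a
scalar `ψ(r, i)`, with `ψ(r, 0) = a_r`, `ψ(0, i) = 1` and
`ψ(r + 1, i + 1) = ψ(r + 1, i) + e ψ(r, i + 1)` (`PowerSystem.φ_succ_succ`, `PowerSystem.φ_eq`).
The last letter of `P_r ⊗ P_i` comes from `P_i`, which leaves the partial trace for `(r, i - 1)`, or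
from `P_r`, in which case yanking the strand of that letter straight gives the one for `(r - 1, i)`.
Cyclicity of the full trace now gives `C(r + i, i) a_{r+i} = ψ(r, i) a_i`
(`PowerSystem.choose_mul_catDim_eq`). No division by factorials occurs anywhere, so the
characteristic is irrelevant up to this point.

With `f(z) = ∑ a_r z^r` the recursion says `∑_r ψ(r, i) z^r = f(z) (1 - e z)^{-i}`. In
characteristic `p`, for `q = p^s` and `i = q n`, the last factor is `(1 - e z^q)^{-n}`, so
`ψ(q, q n) = a_q + n e`, while `C(q (n + 1), q n) = n + 1` by Lucas. Hence
`(n + 1) a_{q(n+1)} = (a_q + n e) a_{q n}` (`succ_mul_apply_prime_pow_mul`). For the coefficients of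
`f(-e z)`, again called `aₙ`, this is the recursion `(n + 1) a_{q(n+1)} = (a_q - n) a_{q n}` of the
binomial coefficients `C(a_q, n)`; at `n = p - 1` it forces `∏_{i < p} (a_q - i) = 0`, so that `a_q`
is in the prime field, say `a_{p^s} = t_s` with a digit `t_s`, and then the series is
`∏ (1 + z^{p^s})^{t_s}` (`mk_eq_onePlusPow`). Uniqueness holds because the coefficient of `z^{p^s}`
in `(1 + z)^t` is the digit `t_s` (`coeff_pow_onePlusPow`); for `s = 0` this coefficient is also the
dimension of `P₁ = X`, up to the sign conventions, which gives the reduction modulo `p`.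
-/

noncomputable section

namespace PadicDimension

/-! ### Partial traces in symmetric monoidal categories -/

section PartialTrace

variable {C : Type*} [Category* C] [MonoidalCategory C] [SymmetricCategory C]

/-- The coevaluation of a right dual `A'` of `A`, followed by the symmetry: a morphism
`𝟙 ⟶ A' ⊗ A`. -/
def coevL (A A' : C) [ExactPairing A A'] : 𝟙_ C ⟶ A' ⊗ A := η_ A A' ≫ (β_ A A').hom

/-- The partial trace over the left factor `A` of a morphism `A ⊗ B ⟶ A ⊗ B'`, with the dual `A'` of
`A` given explicitly. The full trace of an endomorphism `f` of `A` is `ltr A A' (f ▷ 𝟙_ C)`. -/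
def ltr (A A' : C) [ExactPairing A A'] {B B' : C} (f : A ⊗ B ⟶ A ⊗ B') : B ⟶ B' :=
  (λ_ B).inv ≫ coevL A A' ▷ B ≫ (α_ _ _ _).hom ≫ A' ◁ f ≫ (α_ _ _ _).inv ≫ ε_ A A' ▷ B' ≫
    (λ_ B').hom

variable {A A' : C} [ExactPairing A A']

theorem ltr_whiskerLeft_comp {B₀ B B' : C} (u : B₀ ⟶ B) (f : A ⊗ B ⟶ A ⊗ B') :
    ltr A A' (A ◁ u ≫ f) = u ≫ ltr A A' f := by
  simp only [ltr, whiskerLeft_comp, Category.assoc]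
  rw [leftUnitor_inv_naturality_assoc, whisker_exchange_assoc]
  simp

theorem ltr_comp_whiskerLeft {B B' B'' : C} (f : A ⊗ B ⟶ A ⊗ B') (v : B' ⟶ B'') :
    ltr A A' (f ≫ A ◁ v) = ltr A A' f ≫ v := by
  simp only [ltr, whiskerLeft_comp, Category.assoc]
  rw [← leftUnitor_naturality, ← whisker_exchange_assoc]
  simp

/-- The partial trace commutes with adding a strand on the right. -/
theorem ltr_whiskerRight {B B' : C} (f : A ⊗ B ⟶ A ⊗ B') (Z : C) :
    ltr A A' ((α_ A B Z).inv ≫ f ▷ Z ≫ (α_ A B' Z).hom) = ltr A A' f ▷ Z := by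
  simp only [ltr]
  monoidal

theorem ltr_add [Preadditive C] [MonoidalPreadditive C] {B B' : C} (f g : A ⊗ B ⟶ A ⊗ B') :
    ltr A A' (f + g) = ltr A A' f + ltr A A' g := by
  simp [ltr, MonoidalPreadditive.whiskerLeft_add]

theorem ltr_smul {k : Type*} [Semiring k] [Preadditive C] [Linear k C] [MonoidalPreadditive C]
    [MonoidalLinear k C] {B B' : C} (a : k) (f : A ⊗ B ⟶ A ⊗ B') :
    ltr A A' (a • f) = a • ltr A A' f := by
  simp [ltr]

omit [SymmetricCategory C] in
/-- The mate of `f`, for arbitrary choices of duals. -/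
theorem whiskerRight_coev {R R' : C} [ExactPairing R R'] (f : A ⟶ R) :
    ∃ g : R' ⟶ A', η_ A A' ≫ f ▷ A' = η_ R R' ≫ R ◁ g ∧ g ▷ A ≫ ε_ A A' = R' ◁ f ≫ ε_ R R' := by
  let _ : HasRightDual A := ⟨A'⟩
  let _ : HasRightDual R := ⟨R'⟩
  exact ⟨fᘁ, (coevaluation_comp_rightAdjointMate f).symm, rightAdjointMate_comp_evaluation f⟩

/-- Cyclicity of the partial trace: a morphism on the traced strand can be moved around the loop. -/
theorem ltr_cyclic {R R' : C} [ExactPairing R R'] {B B' : C} (f : A ⟶ R)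
    (g : R ⊗ B ⟶ A ⊗ B') :
    ltr A A' (f ▷ B ≫ g) = ltr R R' (g ≫ f ▷ B') := by
  obtain ⟨h, h1, h2⟩ := whiskerRight_coev (A' := A') (R' := R') f
  have h3 : coevL A A' ≫ A' ◁ f = coevL R R' ≫ h ▷ R := by
    simp only [coevL, Category.assoc]
    rw [← BraidedCategory.braiding_naturality_left, reassoc_of% h1,
      BraidedCategory.braiding_naturality_right]
  simp only [ltr]
  congr 1
  calc _ = (coevL A A' ≫ A' ◁ f) ▷ B ⊗≫ A' ◁ g ⊗≫ ε_ A A' ▷ B' ≫ (λ_ B').hom := by monoidal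
    _ = coevL R R' ▷ B ⊗≫ (h ▷ (R ⊗ B) ≫ A' ◁ g) ⊗≫ ε_ A A' ▷ B' ≫ (λ_ B').hom := by
      rw [h3]; monoidal
    _ = coevL R R' ▷ B ⊗≫ R' ◁ g ⊗≫ (h ▷ A ≫ ε_ A A') ▷ B' ≫ (λ_ B').hom := by
      rw [← whisker_exchange]; monoidal
    _ = _ := by rw [h2]; monoidal

/-- The partial trace of a crossing is a straight strand. -/
theorem ltr_braiding : ltr A A' (β_ A A).hom = 𝟙 A := by
  have h : (β_ A A').hom ▷ A ≫ (α_ _ _ _).hom ≫ A' ◁ (β_ A A).hom ≫ (α_ _ _ _).inv =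
      (α_ _ _ _).hom ≫ (β_ A (A' ⊗ A)).hom := by
    simp [BraidedCategory.braiding_tensor_right_hom]
  simp only [ltr, coevL, comp_whiskerRight, Category.assoc]
  rw [reassoc_of% h, ← BraidedCategory.braiding_naturality_right_assoc]
  have := ExactPairing.evaluation_coevaluation A A'
  rw [reassoc_of% this]
  simp

/-- Yanking: when the traced strand crosses `B` and closes up with the strand that leaves `M`, the
loop can be pulled straight. -/
theorem ltr_braiding_comp {B B' : C} (M : B ⟶ A ⊗ B') :
    ltr A A' ((β_ A B).hom ≫ M ▷ A ≫ (α_ _ _ _).hom) = M ≫ (β_ A B').hom := by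
  have h : (β_ A B).hom ≫ M ▷ A ≫ (α_ _ _ _).hom =
      A ◁ M ≫ ((α_ _ _ _).inv ≫ (β_ A A).hom ▷ B' ≫ (α_ _ _ _).hom) ≫ A ◁ (β_ A B').hom := by
    rw [← BraidedCategory.braiding_naturality_right_assoc]
    simp [BraidedCategory.braiding_tensor_right_hom]
  rw [h, ltr_whiskerLeft_comp, ltr_comp_whiskerLeft, ltr_whiskerRight, ltr_braiding]
  simp

/-- The twisted coevaluation of a tensor product is the nesting of those of the factors. -/
theorem coevL_tensor (X X' : C) [ExactPairing X X'] :
    coevL (A ⊗ X) (X' ⊗ A') =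
      coevL X X' ⊗≫ X' ◁ (coevL A A' ▷ X) ⊗≫ 𝟙 _ := by
  have h1 : A ◁ coevL X X' ⊗≫ (β_ A X').hom ▷ X ⊗≫ 𝟙 (X' ⊗ A ⊗ X) =
      𝟙 _ ⊗≫ coevL X X' ▷ A ⊗≫ X' ◁ (β_ X A).hom := by
    have := BraidedCategory.braiding_naturality_right A (coevL X X')
    rw [BraidedCategory.braiding_tensor_right_hom] at this
    have h2 : A ◁ coevL X X' ⊗≫ (β_ A X').hom ▷ X ⊗≫ 𝟙 (X' ⊗ A ⊗ X) =
        (A ◁ coevL X X' ≫ (α_ _ _ _).inv ≫ (β_ A X').hom ▷ X ≫ (α_ _ _ _).hom ≫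
          X' ◁ (β_ A X).hom ≫ (α_ _ _ _).inv) ⊗≫ X' ◁ (β_ X A).hom := by
      simp [monoidalComp, ← whiskerLeft_comp]
    rw [h2, this]
    simp [monoidalComp]
  have h3 : X ◁ η_ A A' ⊗≫ (β_ X A).hom ▷ A' ⊗≫ A ◁ (β_ X A').hom =
      𝟙 _ ⊗≫ η_ A A' ▷ X ⊗≫ 𝟙 _ := by
    have := BraidedCategory.braiding_naturality_right X (η_ A A')
    rw [BraidedCategory.braiding_tensor_right_hom] at this
    have h2 : X ◁ η_ A A' ⊗≫ (β_ X A).hom ▷ A' ⊗≫ A ◁ (β_ X A').hom =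
        (X ◁ η_ A A' ≫ (α_ _ _ _).inv ≫ (β_ X A).hom ▷ A' ≫ (α_ _ _ _).hom ≫
          A ◁ (β_ X A').hom ≫ (α_ _ _ _).inv) ⊗≫ 𝟙 _ := by
      simp [monoidalComp]
    rw [h2, this]
    simp [monoidalComp]
  -- By `h1`, the strand `A` passes the pair `X' ⊗ X`; by `h3`, the strand `X` passes the pair
  -- `A ⊗ A'`.
  calc _ = η_ A A' ⊗≫ A ◁ (coevL X X' ▷ A') ⊗≫ (β_ A X').hom ▷ (X ⊗ A') ⊗≫
          X' ◁ A ◁ (β_ X A').hom ⊗≫ X' ◁ (β_ A A').hom ▷ X ⊗≫ 𝟙 _ := by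
        simp [coevL, ExactPairing.tensor_coevaluation, monoidalComp,
          BraidedCategory.braiding_tensor_right_hom, BraidedCategory.braiding_tensor_left_hom]
    _ = 𝟙 _ ⊗≫ (η_ A A' ▷ 𝟙_ C) ⊗≫ (A ◁ coevL X X' ⊗≫ (β_ A X').hom ▷ X ⊗≫
          𝟙 (X' ⊗ A ⊗ X)) ▷ A' ⊗≫
          X' ◁ A ◁ (β_ X A').hom ⊗≫ X' ◁ (β_ A A').hom ▷ X ⊗≫ 𝟙 _ := by
        monoidal
    _ = 𝟙 _ ⊗≫ (𝟙_ C ◁ η_ A A' ≫ coevL X X' ▷ (A ⊗ A')) ⊗≫ X' ◁ (β_ X A).hom ▷ A' ⊗≫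
          X' ◁ A ◁ (β_ X A').hom ⊗≫ X' ◁ (β_ A A').hom ▷ X ⊗≫ 𝟙 _ := by
        rw [h1]
        monoidal
    _ = coevL X X' ⊗≫ X' ◁ (X ◁ η_ A A' ⊗≫ (β_ X A).hom ▷ A' ⊗≫ A ◁ (β_ X A').hom) ⊗≫
          X' ◁ (β_ A A').hom ▷ X ⊗≫ 𝟙 _ := by
        rw [whisker_exchange]
        monoidal
    _ = _ := by
        rw [h3]
        simp only [coevL]
        monoidal

/-- The partial trace over `A ⊗ X` can be taken in two steps. -/
theorem ltr_tensor (X X' : C) [ExactPairing X X'] {B B' : C} (f : (A ⊗ X) ⊗ B ⟶ (A ⊗ X) ⊗ B') :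
    ltr (A ⊗ X) (X' ⊗ A') f = ltr X X' (ltr A A' ((α_ _ _ _).inv ≫ f ≫ (α_ _ _ _).hom)) := by
  simp only [ltr, coevL_tensor, ExactPairing.tensor_evaluation]
  monoidal

end PartialTrace

/-! ### Systems of symmetric or exterior powers and their product -/

section SwapR

variable {C : Type*} [Category* C] [MonoidalCategory C] [SymmetricCategory C]

/-- The isomorphism `(Y ⊗ X) ⊗ W ⟶ (Y ⊗ W) ⊗ X` that exchanges the last two of three factors. -/
def swapR (Y X W : C) : (Y ⊗ X) ⊗ W ⟶ (Y ⊗ W) ⊗ X :=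
  (α_ Y X W).hom ≫ Y ◁ (β_ X W).hom ≫ (α_ Y W X).inv

theorem swapR_natural_left {Y Y' : C} (f : Y ⟶ Y') (X W : C) :
    f ▷ X ▷ W ≫ swapR Y' X W = swapR Y X W ≫ f ▷ W ▷ X := by
  simp only [swapR, Category.assoc, ← associator_inv_naturality_left,
    associator_naturality_left_assoc, whisker_exchange_assoc]

theorem swapR_natural_middle (Y : C) {X X' : C} (f : X ⟶ X') (W : C) :
    (Y ◁ f) ▷ W ≫ swapR Y X' W = swapR Y X W ≫ (Y ⊗ W) ◁ f := by
  simp only [swapR, Category.assoc, ← associator_inv_naturality_right,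
    associator_naturality_middle_assoc, ← whiskerLeft_comp_assoc,
    BraidedCategory.braiding_naturality_left]

theorem swapR_natural_right (Y X : C) {W W' : C} (g : W ⟶ W') :
    (Y ⊗ X) ◁ g ≫ swapR Y X W' = swapR Y X W ≫ (Y ◁ g) ▷ X := by
  simp only [swapR, Category.assoc, ← associator_inv_naturality_middle,
    associator_naturality_right_assoc, ← whiskerLeft_comp_assoc,
    BraidedCategory.braiding_naturality_right]

theorem swapR_tensor_right (Y X W X' : C) :
    swapR Y X (W ⊗ X') ≫ (α_ Y W X').inv ▷ X =
      (α_ (Y ⊗ X) W X').inv ≫ swapR Y X W ▷ X' ≫ swapR (Y ⊗ W) X X' := by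
  simp [swapR, BraidedCategory.braiding_tensor_right_hom]

theorem swapR_tensor_middle (Y X X' W : C) :
    swapR (Y ⊗ X) X' W ≫ swapR Y X W ▷ X' ≫ (α_ (Y ⊗ W) X X').hom =
      (α_ Y X X').hom ▷ W ≫ swapR Y (X ⊗ X') W := by
  simp [swapR, BraidedCategory.braiding_tensor_left_hom]

/-- The topological core of the Pascal recursion: if the last letter `X` of the traced object `R` is
split off by `δ`, passes `B` and is put behind the output of `K`, then it is a strand that yanking
straightens, and a trace over `A` alone remains. -/
theorem ltr_swapR {A A' X X' R R' : C} [ExactPairing A A'] [ExactPairing X X'] [ExactPairing R R']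
    {B B' : C} (δ : R ⟶ A ⊗ X) (K : A ⊗ B ⟶ R ⊗ B') :
    ltr R R' (δ ▷ B ≫ swapR A X B ≫ K ▷ X ≫ (α_ _ _ _).hom) =
      ltr A A' (K ≫ δ ▷ B' ≫ swapR A X B' ≫ (α_ _ _ _).hom) := by
  rw [ltr_cyclic (R' := X' ⊗ A'), ltr_tensor]
  have h : (α_ A X B).inv ≫ ((swapR A X B ≫ K ▷ X ≫ (α_ _ _ _).hom) ≫ δ ▷ (B' ⊗ X)) ≫
      (α_ _ _ _).hom = A ◁ (β_ X B).hom ≫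
        ((α_ _ _ _).inv ≫ (K ≫ δ ▷ B' ≫ (α_ _ _ _).hom) ▷ X ≫ (α_ _ _ _).hom) ≫
          A ◁ (α_ _ _ _).hom := by
    simp [swapR]
  rw [h, ltr_whiskerLeft_comp, ltr_comp_whiskerLeft, ltr_whiskerRight, ltr_braiding_comp,
    ← ltr_comp_whiskerLeft]
  simp [swapR]

end SwapR

section Rigid

variable {C : Type*} [Category* C] [MonoidalCategory C]

theorem mono_whiskerLeft [RightRigidCategory C] (A : C) {B B' : C} (f : B ⟶ B') [Mono f] :
    Mono (A ◁ f) := by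
  have := (tensorLeftAdjunction A Aᘁ).isRightAdjoint
  exact (inferInstance : Mono ((tensorLeft A).map f))

theorem mono_whiskerRight [LeftRigidCategory C] {B B' : C} (f : B ⟶ B') [Mono f] (A : C) :
    Mono (f ▷ A) := by
  have := (tensorRightAdjunction (ᘁA) A).isRightAdjoint
  exact (inferInstance : Mono ((tensorRight A).map f))

end Rigid

/-- A system of objects `P n` that behave like the symmetric powers (`sign = 1`) or the exterior
powers (`sign = -1`) of `X`, with `P (n + 1)` contained in `P n ⊗ X`. The morphism `π` on `X ⊗ X`
cuts out the (skew-)symmetric part: the object `P (n + 2)` is the kernel of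
`P (n + 1) ⊗ X ⟶ P n ⊗ X ⊗ X ⟶ P n ⊗ N`. -/
structure PowerSystem (k : Type*) [Field k] {C : Type*} [Category* C] [Preadditive C] [Linear k C]
    [MonoidalCategory C] [SymmetricCategory C] (X : C) where
  /-- The powers. -/
  P : ℕ → C
  /-- Splitting off the last letter. -/
  δ : ∀ n, P (n + 1) ⟶ P n ⊗ X
  /-- The scalar by which exchanges of adjacent letters act. -/
  sign : k
  sign_mul_self : sign * sign = 1
  /-- The target of `π`. -/
  N : C
  /-- The morphism whose kernel is the square `P 2`. -/
  π : X ⊗ X ⟶ N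
  /-- The morphism by which `c - sign` factors through `π`, where `c` is the symmetry. -/
  τ : N ⟶ X ⊗ X
  /-- The power of exponent `0` is the unit object. -/
  unitIso : P 0 ≅ 𝟙_ C
  isIso_δ_zero : IsIso (δ 0)
  mono_δ : ∀ n, Mono (δ n)
  symmetrize_π : (𝟙 _ + sign • (β_ X X).hom) ≫ π = 0
  π_τ : π ≫ τ = (β_ X X).hom - sign • 𝟙 _
  δ_δ_π : ∀ n, δ (n + 1) ≫ δ n ▷ X ≫ (α_ _ _ _).hom ≫ P n ◁ π = 0
  exists_lift : ∀ n {Z : C} (g : Z ⟶ P (n + 1) ⊗ X),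
    g ≫ δ n ▷ X ≫ (α_ _ _ _).hom ≫ P n ◁ π = 0 → ∃ l : Z ⟶ P (n + 2), l ≫ δ (n + 1) = g

namespace PowerSystem

variable {k : Type*} [Field k] {C : Type*} [Category* C] [Preadditive C] [Linear k C]
    [MonoidalCategory C] [SymmetricCategory C] {X : C} (S : PowerSystem k X)

attribute [instance] isIso_δ_zero mono_δ

section Mul

/-- The part of the product `P m ⊗ P q ⟶ P (n + 1) ⟶ P n ⊗ X` in which the last letter comes from
the right factor, in terms of the products `M` of total degree `n`. It vanishes if `q = 0`. -/
def dR {n : ℕ} (M : ∀ m q, m + q = n → (S.P m ⊗ S.P q ⟶ S.P n)) :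
    ∀ m q, m + q = n + 1 → (S.P m ⊗ S.P q ⟶ S.P n ⊗ X)
  | _, 0, _ => 0
  | m, q + 1, h => S.P m ◁ S.δ q ≫ (α_ _ _ _).inv ≫ M m q (by omega) ▷ X

/-- The part of the product `P m ⊗ P q ⟶ P (n + 1) ⟶ P n ⊗ X` in which the last letter comes from
the left factor and is moved past the right factor, without the sign of that move. It vanishes if
`m = 0`. -/
def dL {n : ℕ} (M : ∀ m q, m + q = n → (S.P m ⊗ S.P q ⟶ S.P n)) :
    ∀ m q, m + q = n + 1 → (S.P m ⊗ S.P q ⟶ S.P n ⊗ X)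
  | 0, _, _ => 0
  | m + 1, q, h => S.δ m ▷ S.P q ≫ swapR _ _ _ ≫ M m q (by omega) ▷ X

open Classical in
/-- The factorization of `g` through `δ n` if there is one, and `0` otherwise. -/
def lift {Z : C} (n : ℕ) (g : Z ⟶ S.P n ⊗ X) : Z ⟶ S.P (n + 1) :=
  if h : ∃ l, l ≫ S.δ n = g then h.choose else 0

theorem lift_δ {Z : C} {n : ℕ} {g : Z ⟶ S.P n ⊗ X} (h : ∃ l, l ≫ S.δ n = g) :
    S.lift n g ≫ S.δ n = g := by
  rw [lift, dif_pos h]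
  exact h.choose_spec

/-- The shuffle product `P m ⊗ P q ⟶ P n` for `m + q = n`, by recursion on the last letter, see
`mul_δ`. The letter from the left factor passes `q` letters, hence the sign. The degree `n` is an
argument of its own, which avoids transport along equalities of natural numbers. -/
def mul : ∀ n m q, m + q = n → (S.P m ⊗ S.P q ⟶ S.P n)
  | 0, 0, 0, _ => S.unitIso.hom ▷ _ ≫ (λ_ _).hom
  | 0, _ + 1, _, _ => 0
  | 0, 0, _ + 1, _ => 0
  | n + 1, m, q, h => S.lift n (S.dR (mul n) m q h + S.sign ^ q • S.dL (mul n) m q h)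

/-- Exchanging the last two letters acts on the power by the sign. -/
theorem δ_δ_swapR [MonoidalPreadditive C] [MonoidalLinear k C] (n : ℕ) :
    S.δ (n + 1) ≫ S.δ n ▷ X ≫ swapR _ _ _ = S.sign • S.δ (n + 1) ≫ S.δ n ▷ X := by
  have h := S.δ_δ_π n =≫ (S.P n ◁ S.τ ≫ (α_ _ _ _).inv)
  have h1 : S.P n ◁ S.π ≫ S.P n ◁ S.τ = S.P n ◁ (β_ X X).hom - S.sign • 𝟙 _ := by
    rw [← whiskerLeft_comp, S.π_τ, sub_eq_add_neg, MonoidalPreadditive.whiskerLeft_add,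
      ← neg_smul, MonoidalLinear.whiskerLeft_smul, whiskerLeft_id, neg_smul, sub_eq_add_neg]
  simp only [Category.assoc, reassoc_of% h1, zero_comp] at h
  rw [← sub_eq_zero, ← h]
  simp [swapR]

variable {n : ℕ} (M : ∀ m q, m + q = n → (S.P m ⊗ S.P q ⟶ S.P n))

/-- If both of the last two letters come from the right factor, they are (skew-)symmetric. -/
theorem dR_dR_π [MonoidalPreadditive C] {m q : ℕ} (h : m + q = n + 1) :
    S.P m ◁ S.δ q ≫ (α_ _ _ _).inv ≫ S.dR M m q h ▷ X ≫ (α_ _ _ _).hom ≫ S.P n ◁ S.π = 0 := by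
  cases q with
  | zero => simp [dR]
  | succ q =>
    have h1 : S.P m ◁ S.δ (q + 1) ≫ (α_ _ _ _).inv ≫ S.dR M m (q + 1) h ▷ X ≫ (α_ _ _ _).hom ≫
        S.P n ◁ S.π = S.P m ◁ (S.δ (q + 1) ≫ S.δ q ▷ X ≫ (α_ _ _ _).hom ≫ S.P q ◁ S.π) ≫
          (α_ _ _ _).inv ≫ M m q (by omega) ▷ _ := by
      simp only [dR, whiskerLeft_comp, Category.assoc, associator_inv_naturality_right_assoc,
        whisker_exchange]
      monoidal
    rw [h1, S.δ_δ_π]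
    simp

/-- If both of the last two letters come from the left factor, they are (skew-)symmetric. -/
theorem dL_dL_π [MonoidalPreadditive C] {m q : ℕ} (h : m + q = n + 1) :
    S.δ m ▷ S.P q ≫ swapR _ _ _ ≫ S.dL M m q h ▷ X ≫ (α_ _ _ _).hom ≫ S.P n ◁ S.π = 0 := by
  cases m with
  | zero => simp [dL]
  | succ m =>
    have h1 : S.δ (m + 1) ▷ S.P q ≫ swapR _ _ _ ≫ S.dL M (m + 1) q h ▷ X ≫ (α_ _ _ _).hom ≫
        S.P n ◁ S.π = (S.δ (m + 1) ≫ S.δ m ▷ X ≫ (α_ _ _ _).hom ≫ S.P m ◁ S.π) ▷ S.P q ≫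
          swapR _ _ _ ≫ M m q (by omega) ▷ _ := by
      simp only [dL, comp_whiskerRight, Category.assoc, associator_naturality_left_assoc,
        ← whisker_exchange, reassoc_of% @swapR_natural_middle,
        ← reassoc_of% @swapR_tensor_middle, reassoc_of% @swapR_natural_left]
    rw [h1, S.δ_δ_π]
    simp

/-- Taking the last letter from the left and the one before from the right differs from the opposite
choice by the exchange of the two letters. -/
theorem dL_dR {m q : ℕ} (h : m + (q + 1) = n + 1) (h' : m + 1 + q = n + 1) :
    S.δ m ▷ S.P (q + 1) ≫ swapR _ _ _ ≫ S.dR M m (q + 1) h ▷ X =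
      S.P (m + 1) ◁ S.δ q ≫ (α_ _ _ _).inv ≫ S.dL M (m + 1) q h' ▷ X ≫ swapR _ _ _ := by
  simp only [dL, dR, comp_whiskerRight, Category.assoc, swapR_natural_left,
    ← reassoc_of% @swapR_natural_right, reassoc_of% @swapR_tensor_right,
    ← associator_inv_naturality_left_assoc,
    whisker_exchange_assoc]

variable [MonoidalPreadditive C] [MonoidalLinear k C]

/-- The recursion that defines the product: the factorization used in `mul` exists, because the two
mixed terms add up to a (skew-)symmetrization, which `π` annihilates. -/
theorem mul_δ : ∀ (n m q : ℕ) (h : m + q = n + 1), S.mul (n + 1) m q h ≫ S.δ n =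
    S.dR (S.mul n) m q h + S.sign ^ q • S.dL (S.mul n) m q h := by
  intro n
  induction n with
  | zero =>
    intro m q h
    rw [mul]
    exact S.lift_δ ⟨(_ : _ ⟶ S.P 0 ⊗ X) ≫ inv (S.δ 0), by
      rw [Category.assoc, IsIso.inv_hom_id, Category.comp_id]⟩
  | succ n ih =>
    intro m q h
    rw [mul]
    refine S.lift_δ (S.exists_lift _ _ ?_)
    have hR : ∀ m q h, S.dR (S.mul (n + 1)) m (q + 1) h ≫ S.δ n ▷ X =
        S.P m ◁ S.δ q ≫ (α_ _ _ _).inv ≫ S.dR (S.mul n) m q (by omega) ▷ X +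
          S.sign ^ q • S.P m ◁ S.δ q ≫ (α_ _ _ _).inv ≫ S.dL (S.mul n) m q (by omega) ▷ X := by
      intro m q h
      simp [dR, ← comp_whiskerRight, ih]
    have hL : ∀ m q h, S.dL (S.mul (n + 1)) (m + 1) q h ≫ S.δ n ▷ X =
        S.δ m ▷ S.P q ≫ swapR _ _ _ ≫ S.dR (S.mul n) m q (by omega) ▷ X +
          S.sign ^ q • S.δ m ▷ S.P q ≫ swapR _ _ _ ≫ S.dL (S.mul n) m q (by omega) ▷ X := by
      intro m q h
      simp [dL, ← comp_whiskerRight, ih]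
    -- The exchange acts by `-sign` after `π`, so the two mixed terms below cancel.
    have hsym : swapR (S.P n) X X ≫ (α_ _ _ _).hom ≫ S.P n ◁ S.π =
        - S.sign • (α_ _ _ _).hom ≫ S.P n ◁ S.π := by
      have h1 := congrArg (fun f => (α_ _ _ _).hom ≫ S.P n ◁ f) S.symmetrize_π
      simp only [whiskerLeft_comp, MonoidalPreadditive.whiskerLeft_add,
        MonoidalLinear.whiskerLeft_smul, Preadditive.add_comp, Preadditive.comp_add,
        Category.id_comp, Linear.smul_comp, Linear.comp_smul,
        MonoidalPreadditive.whiskerLeft_zero, comp_zero] at h1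
      have h2 := congrArg (S.sign • ·) h1
      simp only [smul_add, smul_smul, S.sign_mul_self, one_smul, smul_zero] at h2
      simp only [swapR, Category.assoc, Iso.inv_hom_id_assoc, neg_smul]
      rw [eq_neg_iff_add_eq_zero, add_comm, h2]
    match m, q, h with
    | 0, 0, h => omega
    | 0, q + 1, h =>
      have h1 : S.dL (S.mul (n + 1)) 0 (q + 1) h = 0 := rfl
      have h2 : S.dL (S.mul n) 0 q (by omega) = 0 := rfl
      rw [h1, smul_zero, add_zero, reassoc_of% (hR 0 q h), h2]
      simp [S.dR_dR_π]
    | m + 1, 0, h =>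
      have h1 : S.dR (S.mul (n + 1)) (m + 1) 0 h = 0 := rfl
      have h2 : S.dR (S.mul n) m 0 (by omega) = 0 := rfl
      rw [h1, zero_add, Linear.smul_comp, reassoc_of% (hL m 0 h), h2]
      simp [S.dL_dL_π]
    | m + 1, q + 1, h =>
      rw [Preadditive.add_comp, Linear.smul_comp, reassoc_of% (hR (m + 1) q h),
        reassoc_of% (hL m (q + 1) h)]
      simp only [Preadditive.add_comp, Linear.smul_comp, Category.assoc, S.dR_dR_π, S.dL_dL_π]
      rw [reassoc_of% (S.dL_dR (S.mul n) (m := m) (q := q) (by omega) (by omega)), hsym]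
      simp [smul_smul, pow_succ, mul_assoc, S.sign_mul_self]

end Mul

end PowerSystem

/-! ### The coproduct and the Pascal recursion for partial traces -/

namespace PowerSystem

variable {k : Type*} [Field k] {C : Type*} [Category* C] [Preadditive C] [Linear k C]
    [MonoidalCategory C] [SymmetricCategory C] {X : C} (S : PowerSystem k X)

section Comul

open Classical in
/-- The factorization of `g` through `A ◁ δ n` if there is one, and `0` otherwise. -/
def liftL {Z : C} (A : C) (n : ℕ) (g : Z ⟶ A ⊗ (S.P n ⊗ X)) : Z ⟶ A ⊗ S.P (n + 1) :=
  if h : ∃ l, l ≫ A ◁ S.δ n = g then h.choose else 0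

theorem liftL_δ {Z A : C} {n : ℕ} {g : Z ⟶ A ⊗ (S.P n ⊗ X)} (h : ∃ l, l ≫ A ◁ S.δ n = g) :
    S.liftL A n g ≫ A ◁ S.δ n = g := by
  rw [liftL, dif_pos h]
  exact h.choose_spec

/-- The deconcatenation coproduct `P n ⟶ P m ⊗ P q` for `m + q = n`, by recursion on the last
letter, see `comul_δ`. -/
def comul (m : ℕ) : ∀ q n, m + q = n → (S.P n ⟶ S.P m ⊗ S.P q)
  | 0, n, h => eqToHom (congrArg S.P h.symm) ≫ (ρ_ (S.P m)).inv ≫ S.P m ◁ S.unitIso.inv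
  | _ + 1, 0, _ => 0
  | q + 1, n + 1, h => S.liftL (S.P m) q (S.δ n ≫ comul m q n (by omega) ▷ X ≫ (α_ _ _ _).hom)

variable [RightRigidCategory C]

/-- The universal property of the power, tensored on the left with an object; duality moves that
object to the source. -/
theorem exists_lift_left [MonoidalPreadditive C] (n : ℕ) {A Z : C}
    (g : Z ⟶ A ⊗ (S.P (n + 1) ⊗ X))
    (hg : g ≫ A ◁ (S.δ n ▷ X ≫ (α_ _ _ _).hom ≫ S.P n ◁ S.π) = 0) :
    ∃ l : Z ⟶ A ⊗ S.P (n + 2), l ≫ A ◁ S.δ (n + 1) = g := by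
  let e (W : C) := tensorLeftHomEquiv Z A Aᘁ W
  have he (W W' : C) (u : Aᘁ ⊗ Z ⟶ W) (v : W ⟶ W') : e W' (u ≫ v) = e W u ≫ A ◁ v :=
    tensorLeftHomEquiv_naturality u v
  obtain ⟨l, hl⟩ := S.exists_lift n ((e _).symm g) (by
    apply (e _).injective
    have h0 : e _ (0 : Aᘁ ⊗ Z ⟶ S.P n ⊗ S.N) = 0 := by
      simpa using he _ _ 0 (0 : S.P n ⊗ S.N ⟶ S.P n ⊗ S.N)
    rw [he, Equiv.apply_symm_apply, hg, h0])
  exact ⟨e _ l, by rw [← he, hl, Equiv.apply_symm_apply]⟩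

/-- The factorization that is used in the definition of `comul` exists. -/
theorem comul_δ [MonoidalPreadditive C] (m : ℕ) : ∀ (q n : ℕ) (h : m + (q + 1) = n + 1),
    S.comul m (q + 1) (n + 1) h ≫ S.P m ◁ S.δ q =
      S.δ n ≫ S.comul m q n (by omega) ▷ X ≫ (α_ _ _ _).hom := by
  intro q
  induction q with
  | zero =>
    intro n h
    rw [comul]
    refine S.liftL_δ ⟨(S.δ n ≫ S.comul m 0 n (by omega) ▷ X ≫ (α_ _ _ _).hom) ≫
      S.P m ◁ inv (S.δ 0), ?_⟩
    rw [Category.assoc, ← whiskerLeft_comp, IsIso.inv_hom_id, whiskerLeft_id, Category.comp_id]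
  | succ q ih =>
    intro n h
    rw [comul]
    refine S.liftL_δ (S.exists_lift_left q _ ?_)
    obtain ⟨n, rfl⟩ : ∃ n', n = n' + 1 := ⟨n - 1, by omega⟩
    calc (S.δ (n + 1) ≫ S.comul m (q + 1) (n + 1) (by omega) ▷ X ≫ (α_ _ _ _).hom) ≫
          S.P m ◁ (S.δ q ▷ X ≫ (α_ _ _ _).hom ≫ S.P q ◁ S.π)
        = S.δ (n + 1) ≫ (S.comul m (q + 1) (n + 1) (by omega) ≫ S.P m ◁ S.δ q) ▷ X ≫
          (α_ _ _ _).hom ≫ S.P m ◁ ((α_ _ _ _).hom ≫ S.P q ◁ S.π) := by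
          monoidal
      _ = S.δ (n + 1) ≫ S.δ n ▷ X ≫ (α_ _ _ _).hom ≫ (S.comul m q n (by omega) ▷ (X ⊗ X) ≫
          _ ◁ S.π) ≫ (α_ _ _ _).hom := by
          rw [ih]
          monoidal
      _ = (S.δ (n + 1) ≫ S.δ n ▷ X ≫ (α_ _ _ _).hom ≫ S.P n ◁ S.π) ≫
          S.comul m q n (by omega) ▷ _ ≫ (α_ _ _ _).hom := by
          rw [← whisker_exchange]
          simp only [Category.assoc]
      _ = 0 := by rw [S.δ_δ_π, zero_comp]

end Comul

section Linear

variable [MonoidalPreadditive C] [MonoidalLinear k C] [RigidCategory C]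

/-- Splitting the last letter off the left factor of the coproduct: that letter has to be moved past
the `i` letters of the right factor, which costs the sign `sign ^ i`. -/
theorem comul_δ_swapR (j : ℕ) : ∀ (i n : ℕ) (h : j + 1 + i = n + 1),
    S.comul (j + 1) i (n + 1) h ≫ S.δ j ▷ S.P i ≫ swapR _ _ _ =
      S.sign ^ i • S.δ n ≫ S.comul j i n (by omega) ▷ X := by
  intro i
  induction i with
  | zero =>
    intro n h
    obtain rfl : n = j := by omega
    simp only [comul, eqToHom_refl, Category.id_comp, Category.assoc, pow_zero, one_smul]
    rw [whisker_exchange_assoc, swapR_natural_right, ← rightUnitor_inv_naturality_assoc]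
    simp [swapR]
  | succ i ih =>
    intro n h
    obtain ⟨n, rfl⟩ : ∃ n', n = n' + 1 := ⟨n - 1, by omega⟩
    -- The last letter of the right factor is split off as well; exchanging
    -- the two letters contributes one factor `sign`.
    have := mono_whiskerLeft (S.P j) (S.δ i)
    have := mono_whiskerRight (S.P j ◁ S.δ i) X
    rw [← cancel_mono ((S.P j ◁ S.δ i) ▷ X)]
    simp only [Category.assoc, Linear.smul_comp, ← comp_whiskerRight, S.comul_δ]
    rw [← swapR_natural_right, ← whisker_exchange_assoc, reassoc_of% S.comul_δ]
    have h1 : swapR (S.P j) X (S.P i ⊗ X) = (α_ _ _ _).inv ≫ swapR _ _ _ ▷ X ≫ swapR _ _ _ ≫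
        (α_ _ _ _).hom ▷ X := by
      rw [← reassoc_of% @swapR_tensor_right]
      simp
    have h2 := congrArg (fun f => S.δ (n + 1) ≫ f ▷ X ≫ swapR _ _ _ ≫ (α_ _ _ _).hom ▷ X)
      (ih n (by omega))
    simp only [comp_whiskerRight, Category.assoc, MonoidalLinear.smul_whiskerRight,
      Linear.smul_comp, Linear.comp_smul, reassoc_of% @swapR_natural_left,
      reassoc_of% S.δ_δ_swapR] at h2
    rw [h1]
    simp only [associator_inv_naturality_left_assoc, Iso.hom_inv_id_assoc, comp_whiskerRight,
      h2, smul_smul, pow_succ]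

/-- Deconcatenation followed by the shuffle product counts the shuffles. -/
theorem comul_mul : ∀ (n m q : ℕ) (h : m + q = n),
    S.comul m q n h ≫ S.mul n m q h = (n.choose q : k) • 𝟙 _ := by
  intro n
  induction n with
  | zero =>
    intro m q h
    obtain ⟨rfl, rfl⟩ : m = 0 ∧ q = 0 := by omega
    simp only [comul, mul, eqToHom_refl, Category.id_comp, Category.assoc]
    rw [whisker_exchange_assoc, leftUnitor_naturality, ← rightUnitor_inv_naturality_assoc,
      ← unitors_inv_equal]
    simp
  | succ n ih =>
    intro m q h
    rw [← cancel_mono (S.δ n), Category.assoc, S.mul_δ]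
    have hL : S.comul m q (n + 1) h ≫ S.dL (S.mul n) m q h =
        (S.sign ^ q * n.choose q) • S.δ n := by
      match m, h with
      | 0, h => simp [dL, Nat.choose_eq_zero_of_lt (show n < q by omega)]
      | m + 1, h =>
        simp only [dL]
        rw [reassoc_of% (S.comul_δ_swapR m q n h), Linear.smul_comp, Category.assoc,
          ← comp_whiskerRight, ih m q (by omega)]
        simp [smul_smul]
    have hs : S.sign ^ q * S.sign ^ q = 1 := by rw [← mul_pow, S.sign_mul_self, one_pow]
    rw [Preadditive.comp_add, Linear.comp_smul, hL, smul_smul, ← mul_assoc, hs, one_mul,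
      Linear.smul_comp, Category.id_comp]
    match q, h with
    | 0, h => simp [dR]
    | q + 1, h =>
      simp only [dR]
      rw [reassoc_of% S.comul_δ, Iso.hom_inv_id_assoc, ← comp_whiskerRight, ih m q (by omega)]
      simp [Nat.choose_succ_succ, add_smul]

end Linear

section Trace

variable [MonoidalPreadditive C] [MonoidalLinear k C] [RigidCategory C]

/-- The partial trace over `P r` of the endomorphism `mul ≫ comul` of `P r ⊗ P i`. -/
def φ (r i n : ℕ) (h : r + i = n) : S.P i ⟶ S.P i :=
  ltr (S.P r) (S.P r)ᘁ (S.mul n r i h ≫ S.comul r i n h)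

/-- The partial trace, split according to the factor from which the product takes its last
letter. -/
theorem φ_succ_δ (r i n : ℕ) (h : r + (i + 1) = n + 1) :
    S.φ r (i + 1) (n + 1) h ≫ S.δ i = S.δ i ≫ S.φ r i n (by omega) ▷ X +
      S.sign ^ (i + 1) • ltr (S.P r) (S.P r)ᘁ
        (S.dL (S.mul n) r (i + 1) h ≫ S.comul r i n (by omega) ▷ X ≫ (α_ _ _ _).hom) := by
  simp only [φ]
  rw [← ltr_comp_whiskerLeft, Category.assoc, S.comul_δ, reassoc_of% (S.mul_δ n r (i + 1) h),
    Preadditive.add_comp, Linear.smul_comp, ltr_add, ltr_smul, ← ltr_whiskerRight,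
    ← ltr_whiskerLeft_comp]
  simp [dR]

theorem φ_zero_succ (i n : ℕ) (h : 0 + (i + 1) = n + 1) :
    S.φ 0 (i + 1) (n + 1) h ≫ S.δ i = S.δ i ≫ S.φ 0 i n (by omega) ▷ X := by
  rw [S.φ_succ_δ]
  simp [dL, ltr]

/-- The Pascal recursion for the partial traces. -/
theorem φ_succ_succ (r i n : ℕ) (h : r + 1 + (i + 1) = n + 1) :
    S.φ (r + 1) (i + 1) (n + 1) h ≫ S.δ i =
      S.δ i ≫ S.φ (r + 1) i n (by omega) ▷ X +
        S.sign • S.φ r (i + 1) n (by omega) ≫ S.δ i := by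
  obtain ⟨n, rfl⟩ : ∃ n', n = n' + 1 := ⟨n - 1, by omega⟩
  rw [S.φ_succ_δ]
  congr 1
  simp only [dL, Category.assoc]
  -- The term in which the last letter comes from the traced factor.
  rw [← comp_whiskerRight_assoc, ltr_swapR (A' := (S.P r)ᘁ) (X' := Xᘁ), Category.assoc,
    reassoc_of% (S.comul_δ_swapR r i n (by omega))]
  have h1 := S.comul_δ r i n (by omega)
  rw [Linear.smul_comp, Category.assoc, ← h1, Linear.comp_smul, ltr_smul, smul_smul, φ,
    ← ltr_comp_whiskerLeft, Category.assoc]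
  congr 1
  rw [pow_succ, mul_right_comm, ← mul_pow, S.sign_mul_self, one_pow, one_mul]

end Trace

end PowerSystem

/-! ### Dimensions and the scalars by which the partial traces act -/

section UnitTrace

variable {C : Type*} [Category* C] [MonoidalCategory C] [SymmetricCategory C]

theorem ltr_whiskerRight_unit {A A' : C} [ExactPairing A A'] (f : A ⟶ A) :
    ltr A A' (f ▷ 𝟙_ C) = η_ A A' ≫ f ▷ A' ≫ (β_ A A').hom ≫ ε_ A A' := by
  rw [BraidedCategory.braiding_naturality_left_assoc]
  simp only [ltr, coevL]
  monoidal

/-- Cyclicity of the full trace. -/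
theorem ltr_unit_comm {A A' B B' : C} [ExactPairing A A'] [ExactPairing B B'] (f : A ⟶ B)
    (g : B ⟶ A) : ltr A A' ((f ≫ g) ▷ 𝟙_ C) = ltr B B' ((g ≫ f) ▷ 𝟙_ C) := by
  rw [comp_whiskerRight, comp_whiskerRight, ltr_cyclic (R' := B')]

/-- The full trace is the full trace of the partial trace. -/
theorem ltr_unit_tensor {A A' B B' : C} [ExactPairing A A'] [ExactPairing B B']
    (f : A ⊗ B ⟶ A ⊗ B) :
    ltr (A ⊗ B) (B' ⊗ A') (f ▷ 𝟙_ C) = ltr B B' (ltr A A' f ▷ 𝟙_ C) := by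
  rw [ltr_tensor, ltr_whiskerRight]

end UnitTrace

section Dimension

variable (k : Type*) [Field k] {C : Type*} [Category* C] [Abelian C]
    [Linear k C] [MonoidalCategory C] [MonoidalPreadditive C] [MonoidalLinear k C]
    [SymmetricCategory C] [RigidCategory C] [IsSymmetricTensorCategory k C]

theorem unitScalar_smul_id (f : 𝟙_ C ⟶ 𝟙_ C) : unitScalar k f • 𝟙 (𝟙_ C) = f :=
  (Equiv.ofBijective (fun a : k => a • 𝟙 (𝟙_ C))
    IsSymmetricTensorCategory.end_unit).apply_symm_apply f

@[simp]
theorem unitScalar_smul (a : k) (f : 𝟙_ C ⟶ 𝟙_ C) :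
    unitScalar k (a • f) = a * unitScalar k f := by
  apply (IsSymmetricTensorCategory.end_unit (k := k) (C := C)).injective
  simp only [mul_smul, unitScalar_smul_id]

@[simp]
theorem unitScalar_id : unitScalar k (𝟙 (𝟙_ C)) = 1 := by
  apply (IsSymmetricTensorCategory.end_unit (k := k) (C := C)).injective
  simp only [unitScalar_smul_id, one_smul]

/-- The dimension may be computed with any choice of dual. -/
theorem catDim_eq (A A' : C) [ExactPairing A A'] :
    catDim k A = unitScalar k (ltr A A' (𝟙 A ▷ 𝟙_ C)) := by
  have := ltr_unit_comm (A' := A') (B' := Aᘁ) (𝟙 A) (𝟙 A)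
  rw [Category.comp_id] at this
  rw [this, ltr_whiskerRight_unit, catDim, tr]

theorem catDim_congr {A B : C} (e : A ≅ B) : catDim k A = catDim k B := by
  have := ltr_unit_comm (A' := Aᘁ) (B' := Bᘁ) e.hom e.inv
  rw [catDim_eq k A Aᘁ, catDim_eq k B Bᘁ, ← e.hom_inv_id, ← e.inv_hom_id, this]

theorem catDim_unit : catDim k (𝟙_ C) = 1 := by
  have h : ltr (𝟙_ C) (𝟙_ C) (𝟙 (𝟙_ C) ▷ 𝟙_ C) = 𝟙 _ := by
    rw [ltr_whiskerRight_unit]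
    simp [ExactPairing.coevaluation, ExactPairing.evaluation, ExactPairing.coevaluation',
      ExactPairing.evaluation']
    rw [← unitors_equal, Iso.inv_hom_id]
  rw [catDim_eq k _ (𝟙_ C), h, unitScalar_id]

/-- `X` is a dual of its dual, and the dimension does not depend on the choice of dual. -/
theorem catDim_rightDual (X : C) : catDim k Xᘁ = catDim k X := by
  let _ := BraidedCategory.exactPairing_swap X Xᘁ
  have h : η_ Xᘁ X = η_ X Xᘁ ≫ (β_ Xᘁ X).inv := rfl
  have h' : ε_ Xᘁ X = (β_ X Xᘁ).hom ≫ ε_ X Xᘁ := rfl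
  rw [catDim_eq k _ X, ltr_whiskerRight_unit, h, h', catDim, tr]
  rw [← SymmetricCategory.braiding_swap_eq_inv_braiding Xᘁ X]
  simp

end Dimension

namespace PowerSystem

variable {k : Type*} [Field k] {C : Type*} [Category* C] [Abelian C]
    [Linear k C] [MonoidalCategory C] [MonoidalPreadditive C] [MonoidalLinear k C]
    [SymmetricCategory C] [RigidCategory C] [IsSymmetricTensorCategory k C]
    {X : C} (S : PowerSystem k X)

theorem catDim_P_zero : catDim k (S.P 0) = 1 := by
  rw [catDim_congr k S.unitIso, catDim_unit]

/-- The full trace of `comul ≫ mul` equals the one of `mul ≫ comul`, which is computed by first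
tracing over the left factor. -/
theorem choose_mul_catDim {r i n : ℕ} (h : r + i = n) {c : k} (hc : S.φ r i n h = c • 𝟙 _) :
    (n.choose i : k) * catDim k (S.P n) = c * catDim k (S.P i) := by
  have h1 := ltr_unit_comm (A' := (S.P n)ᘁ) (B' := (S.P i)ᘁ ⊗ (S.P r)ᘁ) (S.comul r i n h)
    (S.mul n r i h)
  have h2 : ltr (S.P r) (S.P r)ᘁ (S.mul n r i h ≫ S.comul r i n h) = c • 𝟙 _ := hc
  rw [ltr_unit_tensor, S.comul_mul, h2, MonoidalLinear.smul_whiskerRight,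
    MonoidalLinear.smul_whiskerRight, ltr_smul, ltr_smul] at h1
  have h3 := congrArg (unitScalar k) h1
  rwa [unitScalar_smul, unitScalar_smul, ← catDim_eq, ← catDim_eq] at h3

/-- `P 0` is the unit object, so the partial trace is a scalar there; it is found by comparing full
traces. -/
theorem φ_zero_right (r : ℕ) : S.φ r 0 r rfl = catDim k (S.P r) • 𝟙 _ := by
  obtain ⟨c, hc⟩ : ∃ c : k, S.φ r 0 r rfl = c • 𝟙 _ := by
    refine ⟨unitScalar k (S.unitIso.inv ≫ S.φ r 0 r rfl ≫ S.unitIso.hom), ?_⟩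
    have := congrArg (fun f => S.unitIso.hom ≫ f ≫ S.unitIso.inv)
      (unitScalar_smul_id k (S.unitIso.inv ≫ S.φ r 0 r rfl ≫ S.unitIso.hom))
    simpa using this.symm
  have h := S.choose_mul_catDim _ hc
  rw [S.catDim_P_zero, Nat.choose_zero_right, Nat.cast_one, one_mul, mul_one] at h
  rw [hc, h]

/-- The scalars by which the partial traces `φ` act, see `φ_eq`. The two boundary cases agree at
`(0, 0)`, see `ψ_zero_left`. -/
def ψ : ℕ → ℕ → k
  | r, 0 => catDim k (S.P r)
  | 0, _ + 1 => 1
  | r + 1, i + 1 => ψ (r + 1) i + S.sign * ψ r (i + 1)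

theorem ψ_zero_left (i : ℕ) : S.ψ 0 i = 1 := by
  cases i with
  | zero => rw [ψ, S.catDim_P_zero]
  | succ i => rw [ψ]

theorem φ_eq : ∀ (n r i : ℕ) (h : r + i = n), S.φ r i n h = S.ψ r i • 𝟙 _ := by
  intro n
  induction n with
  | zero =>
    intro r i h
    obtain ⟨rfl, rfl⟩ : r = 0 ∧ i = 0 := by omega
    rw [ψ, ← S.φ_zero_right]
  | succ n ih =>
    intro r i h
    match r, i, h with
    | r, 0, h =>
      obtain rfl : r = n + 1 := h
      rw [ψ, ← S.φ_zero_right]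
    | 0, i + 1, h =>
      rw [← cancel_mono (S.δ i), S.φ_zero_succ, ih, ψ_zero_left, ψ_zero_left]
      simp
    | r + 1, i + 1, h =>
      rw [← cancel_mono (S.δ i), S.φ_succ_succ, ih, ih, ψ]
      simp [add_smul, mul_smul]

theorem choose_mul_catDim_eq (r i : ℕ) :
    ((r + i).choose i : k) * catDim k (S.P (r + i)) = S.ψ r i * catDim k (S.P i) :=
  S.choose_mul_catDim rfl (S.φ_eq _ r i rfl)

end PowerSystem

/-! ### Symmetric and exterior powers as power systems -/

section Exactness

variable {C : Type*} [Category* C] [Abelian C] [MonoidalCategory C] [MonoidalPreadditive C]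

omit [MonoidalCategory C] [MonoidalPreadditive C] in
theorem imageSubobject_factors_iff {A B Z : C} (u : A ⟶ B) (f : Z ⟶ B) :
    (imageSubobject u).Factors f ↔ f ≫ cokernel.π u = 0 := by
  constructor
  · intro h
    have : (imageSubobject u).arrow ≫ cokernel.π u = 0 := by
      rw [← cancel_epi (factorThruImageSubobject u), ← Category.assoc,
        imageSubobject_arrow_comp, cokernel.condition, comp_zero]
    rw [← Subobject.factorThru_arrow _ _ h, Category.assoc, this, comp_zero]
  · intro h
    rw [imageSubobject, Subobject.mk_factors_iff]
    have h1 : kernel.lift _ f h ≫ (Abelian.imageIsoImage u).hom ≫ image.ι u = f :=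
      (congrArg (kernel.lift _ f h ≫ ·) (Abelian.imageIsoImage_hom_comp_image_ι u)).trans
        (kernel.lift_ι _ _ _)
    exact ⟨kernel.lift _ f h ≫ (Abelian.imageIsoImage u).hom, (Category.assoc _ _ _).trans h1⟩

/-- Tensoring on the right is right exact: `cokernel (u ▷ X)` and `cokernel u ⊗ X` annihilate the
same morphisms. -/
theorem comp_cokernel_π_whiskerRight [RightRigidCategory C] {A B Z : C} (u : A ⟶ B) (X : C)
    (f : Z ⟶ B ⊗ X) : f ≫ cokernel.π (u ▷ X) = 0 ↔ f ≫ cokernel.π u ▷ X = 0 := by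
  have := (tensorRightAdjunction X Xᘁ).isLeftAdjoint
  have h : cokernel.π (u ▷ X) ≫ cokernelComparison u (tensorRight X) =
      cokernel.π u ▷ X := π_comp_cokernelComparison u (tensorRight X)
  rw [← h, ← Category.assoc]
  exact (Preadditive.IsIso.comp_right_eq_zero _ _).symm

/-- Tensoring on the left is right exact. -/
theorem comp_cokernel_π_whiskerLeft [LeftRigidCategory C] {A B Z : C} (u : A ⟶ B) (X : C)
    (f : Z ⟶ X ⊗ B) : f ≫ cokernel.π (X ◁ u) = 0 ↔ f ≫ X ◁ cokernel.π u = 0 := by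
  have := (tensorLeftAdjunction (ᘁX) X).isLeftAdjoint
  have h : cokernel.π (X ◁ u) ≫ cokernelComparison u (tensorLeft X) =
      X ◁ cokernel.π u := π_comp_cokernelComparison u (tensorLeft X)
  rw [← h, ← Category.assoc]
  exact (Preadditive.IsIso.comp_right_eq_zero _ _).symm

omit [MonoidalCategory C] [MonoidalPreadditive C] in
theorem comp_conj_eq_zero_iff {A B Z : C} (e : A ≅ B) (u : B ⟶ B) (f : Z ⟶ A) :
    f ≫ e.hom ≫ u ≫ e.inv = 0 ↔ f ≫ e.hom ≫ u = 0 := by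
  rw [← Category.assoc, ← Category.assoc, Preadditive.IsIso.comp_right_eq_zero, Category.assoc]

omit [MonoidalCategory C] [MonoidalPreadditive C] in
theorem comp_cokernel_π_conj {A B Z : C} (e : A ≅ B) (u : B ⟶ B) (f : Z ⟶ A) :
    f ≫ cokernel.π (e.hom ≫ u ≫ e.inv) = 0 ↔ (f ≫ e.hom) ≫ cokernel.π u = 0 := by
  constructor
  · intro h
    have h1 : (e.hom ≫ u ≫ e.inv) ≫ e.hom ≫ cokernel.π u = 0 := by simp
    rw [Category.assoc, ← cokernel.π_desc _ _ h1, ← Category.assoc, h, zero_comp]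
  · intro h
    have h1 : u ≫ e.inv ≫ cokernel.π (e.hom ≫ u ≫ e.inv) = 0 := by
      have h2 := cokernel.condition (e.hom ≫ u ≫ e.inv)
      simp only [Category.assoc] at h2
      rw [← cancel_epi e.hom, h2, comp_zero]
    have h2 : f ≫ cokernel.π (e.hom ≫ u ≫ e.inv) =
        ((f ≫ e.hom) ≫ cokernel.π u) ≫ cokernel.desc _ _ h1 := by
      simp
    rw [h2, h, zero_comp]

/-- Intersections of kernels are preserved by tensoring with `X` on the right; duality moves `X` to
the source. -/
theorem exists_comp_arrow_whiskerRight [LeftRigidCategory C] {B X Z : C} {ι : Type*}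
    (P : Subobject B) {K : ι → C} (κ : ∀ i, B ⟶ K i)
    (hP : ∀ {W : C} (g : W ⟶ B), (∀ i, g ≫ κ i = 0) → P.Factors g) (f : Z ⟶ B ⊗ X)
    (hf : ∀ i, f ≫ κ i ▷ X = 0) : ∃ g : Z ⟶ (P : C) ⊗ X, g ≫ P.arrow ▷ X = f := by
  let e (W : C) := tensorRightHomEquiv Z (ᘁX) X W
  have he (W W' : C) (u : Z ⊗ (ᘁX : C) ⟶ W) (v : W ⟶ W') : e W' (u ≫ v) = e W u ≫ v ▷ X :=
    tensorRightHomEquiv_naturality u v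
  have h0 (W : C) : e W 0 = 0 := by simpa using he _ _ 0 (0 : W ⟶ W)
  have hg : P.Factors ((e B).symm f) := hP _ fun i => by
    apply (e _).injective
    rw [he, Equiv.apply_symm_apply, hf, h0]
  refine ⟨e _ (P.factorThru _ hg), ?_⟩
  rw [← he, Subobject.factorThru_arrow, Equiv.apply_symm_apply]

theorem adjSwap_succ_sub_id [SymmetricCategory C] (X : C) (n : ℕ) (i : Fin n) :
    adjSwap X (n + 1) i.succ - 𝟙 _ = (adjSwap X n i - 𝟙 _) ▷ X := by
  have : (adjSwap X n i - 𝟙 _) ▷ X = adjSwap X n i ▷ X - 𝟙 _ ▷ X :=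
    (tensorRight X).map_sub
  rw [this, id_whiskerRight]
  rfl

theorem adjSwap_zero_sub_id [SymmetricCategory C] (X : C) (n : ℕ) :
    adjSwap X (n + 1) 0 - 𝟙 _ = (α_ (tensorPow X n) X X).hom ≫
      tensorPow X n ◁ ((β_ X X).hom - 𝟙 _) ≫ (α_ (tensorPow X n) X X).inv := by
  have : tensorPow X n ◁ ((β_ X X).hom - 𝟙 _) =
      tensorPow X n ◁ (β_ X X).hom - tensorPow X n ◁ 𝟙 _ := (tensorLeft _).map_sub
  rw [this, whiskerLeft_id, Preadditive.sub_comp, Preadditive.comp_sub, Category.id_comp,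
    Iso.hom_inv_id]
  rfl

end Exactness

section Construct

variable {k : Type*} [Field k] {C : Type*} [Category* C] [Abelian C]
    [Linear k C] [MonoidalCategory C] [MonoidalPreadditive C] [MonoidalLinear k C]
    [SymmetricCategory C] [RigidCategory C]

/-- The common features of the subobjects `𝕊ⁿ X` and `Λⁿ X` of the tensor powers: `Q (n + 1)` is
the intersection of the kernels of morphisms `κ n i`, one for each exchange of adjacent
factors, where `κ (n + 1) 0` is given by `π` on the last two factors and `κ (n + 1) (i + 1)` by
`κ n i`. Since these descriptions of `κ` hold only up to isomorphisms of the targets, they are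
stated in terms of the morphisms that are annihilated. -/
structure KernelFamily (k : Type*) [Field k] {C : Type*} [Category* C] [Abelian C]
    [Linear k C] [MonoidalCategory C] [SymmetricCategory C] (X : C) where
  /-- The powers. -/
  Q : ∀ n, Subobject (tensorPow X n)
  /-- The targets of the morphisms `κ`. -/
  K : ∀ n, Fin n → C
  /-- The morphisms whose kernels are intersected. -/
  κ : ∀ n i, tensorPow X (n + 1) ⟶ K n i
  /-- The scalar by which the exchanges act. -/
  sign : k
  sign_mul_self : sign * sign = 1
  /-- The target of `π`. -/
  N : C
  /-- The condition on two adjacent factors. -/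
  π : X ⊗ X ⟶ N
  /-- The morphism by which `c - sign` factors through `π`, where `c` is the symmetry. -/
  τ : N ⟶ X ⊗ X
  symmetrize_π : (𝟙 _ + sign • (β_ X X).hom) ≫ π = 0
  π_τ : π ≫ τ = (β_ X X).hom - sign • 𝟙 _
  Q_zero : Q 0 = ⊤
  Q_succ : ∀ n {Z : C} (f : Z ⟶ tensorPow X (n + 1)),
    (Q (n + 1)).Factors f ↔ ∀ i, f ≫ κ n i = 0
  κ_zero : ∀ n {Z : C} (f : Z ⟶ tensorPow X (n + 2)),
    f ≫ κ (n + 1) 0 = 0 ↔ f ≫ (α_ _ _ _).hom ≫ tensorPow X n ◁ π = 0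
  κ_succ : ∀ n i {Z : C} (f : Z ⟶ tensorPow X (n + 2)),
    f ≫ κ (n + 1) (Fin.succ i) = 0 ↔ f ≫ κ n i ▷ X = 0

namespace KernelFamily

variable {X : C} (F : KernelFamily k X)

omit [MonoidalPreadditive C] [MonoidalLinear k C] [RigidCategory C] in
theorem factors_Q_add_two (n : ℕ) {Z : C} (f : Z ⟶ tensorPow X (n + 2)) :
    (F.Q (n + 2)).Factors f ↔
      f ≫ (α_ _ _ _).hom ≫ tensorPow X n ◁ F.π = 0 ∧ ∀ i, f ≫ F.κ n i ▷ X = 0 := by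
  rw [F.Q_succ, Fin.forall_fin_succ, F.κ_zero]
  simp only [F.κ_succ]

omit [MonoidalPreadditive C] [MonoidalLinear k C] [RigidCategory C] in
theorem isIso_arrow_zero : IsIso (F.Q 0).arrow := by
  rw [F.Q_zero]
  infer_instance

omit [MonoidalPreadditive C] [MonoidalLinear k C] [RigidCategory C] in
theorem isIso_arrow_one : IsIso (F.Q 1).arrow := by
  have h : (F.Q 1).Factors (𝟙 _) := (F.Q_succ 0 _).2 fun i => i.elim0
  have : IsSplitEpi (F.Q 1).arrow := ⟨⟨_, Subobject.factorThru_arrow _ _ h⟩⟩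
  exact isIso_of_mono_of_isSplitEpi _

omit [MonoidalLinear k C] in
/-- The members of `Q (n + 1)` are in `Q n ⊗ X`: up to tensoring with `X`, they satisfy the
conditions that define `Q n`. -/
theorem exists_δ (n : ℕ) : ∃ d : (F.Q (n + 1) : C) ⟶ (F.Q n : C) ⊗ X,
    d ≫ (F.Q n).arrow ▷ X = (F.Q (n + 1)).arrow := by
  match n with
  | 0 =>
    have := F.isIso_arrow_zero
    have key : ∀ a : (F.Q 1 : C) ⟶ tensorPow X 0 ⊗ X,
        ∃ d, d ≫ (F.Q 0).arrow ▷ X = a := fun a =>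
      ⟨a ≫ inv ((F.Q 0).arrow) ▷ X, by
        rw [Category.assoc, ← comp_whiskerRight, IsIso.inv_hom_id, id_whiskerRight,
          Category.comp_id]⟩
    exact key (F.Q 1).arrow
  | n + 1 =>
    have h : (F.Q (n + 2)).Factors (F.Q (n + 2)).arrow := by
      simpa using Subobject.factors_comp_arrow (P := F.Q (n + 2)) (𝟙 _)
    exact exists_comp_arrow_whiskerRight _ (F.κ n) (fun g hg => (F.Q_succ n g).2 hg) _
      ((F.factors_Q_add_two n _).1 h).2

/-- The inclusion of `Q (n + 1)` in `Q n ⊗ X`. -/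
def δ (n : ℕ) : (F.Q (n + 1) : C) ⟶ (F.Q n : C) ⊗ X := (F.exists_δ n).choose

omit [MonoidalLinear k C] in
theorem δ_arrow (n : ℕ) : F.δ n ≫ (F.Q n).arrow ▷ X = (F.Q (n + 1)).arrow :=
  (F.exists_δ n).choose_spec

omit [MonoidalLinear k C] in
theorem mono_δ (n : ℕ) : Mono (F.δ n) := by
  have : Mono (F.δ n ≫ (F.Q n).arrow ▷ X) := by
    rw [F.δ_arrow]
    exact inferInstanceAs (Mono (F.Q (n + 1)).arrow)
  exact mono_of_mono _ ((F.Q n).arrow ▷ X)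

omit [MonoidalLinear k C] in
theorem isIso_δ_zero : IsIso (F.δ 0) := by
  have := F.isIso_arrow_zero
  have : IsIso (F.δ 0 ≫ (F.Q 0).arrow ▷ X) := by
    rw [F.δ_arrow]
    exact F.isIso_arrow_one
  exact IsIso.of_isIso_comp_right _ ((F.Q 0).arrow ▷ X)

omit [MonoidalLinear k C] [RigidCategory C] [MonoidalPreadditive C] in
theorem arrow_whiskerRight_π (n : ℕ) {Z : C} (g : Z ⟶ ((F.Q n : C) ⊗ X) ⊗ X) :
    (g ≫ (α_ _ _ _).hom ≫ (F.Q n : C) ◁ F.π) ≫ (F.Q n).arrow ▷ F.N =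
      (g ≫ (F.Q n).arrow ▷ X ▷ X) ≫ (α_ _ _ _).hom ≫ tensorPow X n ◁ F.π := by
  simp [whisker_exchange]

/-- The power system of a kernel family. -/
def toPowerSystem : PowerSystem k X where
  P n := F.Q n
  δ := F.δ
  sign := F.sign
  sign_mul_self := F.sign_mul_self
  N := F.N
  π := F.π
  τ := F.τ
  unitIso := @asIso _ _ _ _ (F.Q 0).arrow F.isIso_arrow_zero
  isIso_δ_zero := F.isIso_δ_zero
  mono_δ := F.mono_δ
  symmetrize_π := F.symmetrize_π
  π_τ := F.π_τ
  δ_δ_π n := by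
    have := mono_whiskerRight (F.Q n).arrow F.N
    have h : (F.Q (n + 2)).Factors (F.Q (n + 2)).arrow := by
      simpa using Subobject.factors_comp_arrow (P := F.Q (n + 2)) (𝟙 _)
    have h1 : (F.δ (n + 1) ≫ F.δ n ▷ X) ≫ (F.Q n).arrow ▷ X ▷ X = (F.Q (n + 2)).arrow := by
      rw [Category.assoc, ← comp_whiskerRight, F.δ_arrow]
      exact F.δ_arrow (n + 1)
    rw [← cancel_mono ((F.Q n).arrow ▷ F.N), ← Category.assoc (F.δ (n + 1)),
      F.arrow_whiskerRight_π, h1, zero_comp]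
    exact ((F.factors_Q_add_two n _).1 h).1
  exists_lift n Z g hg := by
    have h0 : (g ≫ F.δ n ▷ X) ≫ (F.Q n).arrow ▷ X ▷ X = g ≫ (F.Q (n + 1)).arrow ▷ X := by
      rw [Category.assoc, ← comp_whiskerRight, F.δ_arrow]
      rfl
    have h : (F.Q (n + 2)).Factors (g ≫ (F.Q (n + 1)).arrow ▷ X) := by
      refine (F.factors_Q_add_two n _).2 ⟨?_, fun i => ?_⟩
      · refine (congrArg (fun a => a ≫ (α_ _ _ _).hom ≫ tensorPow X n ◁ F.π) h0).symm.trans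
          ((F.arrow_whiskerRight_π n (g ≫ F.δ n ▷ X)).symm.trans ?_)
        rw [Category.assoc g, hg, zero_comp]
      · have h2 := (F.Q_succ n (F.Q (n + 1)).arrow).1
          (by simpa using Subobject.factors_comp_arrow (P := F.Q (n + 1)) (𝟙 _)) i
        have h3 : (F.Q (n + 1)).arrow ▷ X ≫ F.κ n i ▷ X = 0 := by
          rw [← comp_whiskerRight, h2]
          simp
        exact (Category.assoc _ _ _).trans ((congrArg (g ≫ ·) h3).trans comp_zero)
    refine ⟨(F.Q (n + 2)).factorThru _ h, ?_⟩
    have := mono_whiskerRight (F.Q (n + 1)).arrow X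
    rw [← cancel_mono ((F.Q (n + 1)).arrow ▷ X), Category.assoc, F.δ_arrow]
    exact Subobject.factorThru_arrow _ _ h

end KernelFamily

omit [MonoidalPreadditive C] [RigidCategory C] in
theorem braiding_sub_id_comp (X : C) :
    ((β_ X X).hom - 𝟙 _) ≫ ((β_ X X).hom + 𝟙 _) = 0 := by
  simp only [Preadditive.comp_add, Preadditive.sub_comp, SymmetricCategory.symmetry,
    Category.id_comp, Category.comp_id]
  abel

/-- The symmetric case: the condition on the last two letters is that `c - 1` annihilates, where `c`
is the symmetry. -/
def symFamily (k : Type*) [Field k] [Linear k C] (X : C) : KernelFamily k X where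
  Q := dualSymPow X
  K n _ := tensorPow X (n + 1)
  κ n i := adjSwap X n i - 𝟙 _
  sign := 1
  sign_mul_self := one_mul 1
  N := X ⊗ X
  π := (β_ X X).hom - 𝟙 _
  τ := 𝟙 _
  symmetrize_π := by
    simp only [Preadditive.comp_sub, Preadditive.add_comp, SymmetricCategory.symmetry,
      Category.id_comp, Category.comp_id, one_smul]
    abel
  π_τ := by simp
  Q_zero := rfl
  Q_succ n Z f := by
    simp only [dualSymPow, Subobject.finset_inf_factors, kernelSubobject_factors_iff,
      Finset.mem_univ, true_imp_iff]
  κ_zero n Z f := by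
    refine (iff_of_eq (congrArg (fun u => f ≫ u = 0) (adjSwap_zero_sub_id X n))).trans ?_
    exact comp_conj_eq_zero_iff (α_ _ _ _) _ f
  κ_succ n i Z f := by
    exact iff_of_eq (congrArg (fun u => f ≫ u = 0) (adjSwap_succ_sub_id X n i))

/-- The exterior case: the image of `c - 1` is the kernel of its cokernel. The morphism `τ` exists
because `(c + 1) (c - 1) = 0`. In characteristic 2 the image is in general smaller than the
kernel of `c + 1`, which is why `π` is not taken to be `c + 1`. -/
def extFamily (k : Type*) [Field k] [Linear k C] (X : C) : KernelFamily k X where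
  Q := dualExtPow X
  K n i := cokernel (adjSwap X n i - 𝟙 _)
  κ n i := cokernel.π (adjSwap X n i - 𝟙 _)
  sign := -1
  sign_mul_self := by simp
  N := cokernel ((β_ X X).hom - 𝟙 _)
  π := cokernel.π ((β_ X X).hom - 𝟙 _)
  τ := cokernel.desc _ ((β_ X X).hom + 𝟙 _) (braiding_sub_id_comp X)
  symmetrize_π := by
    have h : 𝟙 (X ⊗ X) + (-1 : k) • (β_ X X).hom = -((β_ X X).hom - 𝟙 _) := by
      rw [neg_smul, one_smul, neg_sub, sub_eq_add_neg]
    rw [h, Preadditive.neg_comp, cokernel.condition, neg_zero]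
  π_τ := by simp
  Q_zero := rfl
  Q_succ n Z f := by
    simp only [dualExtPow, Subobject.finset_inf_factors, imageSubobject_factors_iff,
      Finset.mem_univ, true_imp_iff]
  κ_zero n Z f := by
    refine (iff_of_eq (congrArg (fun u => f ≫ cokernel.π u = 0)
      (adjSwap_zero_sub_id X n))).trans ?_
    exact (comp_cokernel_π_conj (α_ _ _ _) _ f).trans
      ((comp_cokernel_π_whiskerLeft _ _ _).trans
        (iff_of_eq (congrArg (· = 0) (Category.assoc _ _ _))))
  κ_succ n i Z f := by
    refine (iff_of_eq (congrArg (fun u => f ≫ cokernel.π u = 0)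
      (adjSwap_succ_sub_id X n i))).trans ?_
    exact comp_cokernel_π_whiskerRight _ _ f

end Construct

/-! ### Digits, binomial series and the recursion in characteristic `p` -/

section Digits

variable {p : ℕ} [Fact p.Prime]

theorem appr_succ (t : ℤ_[p]) (j : ℕ) : t.appr (j + 1) = p ^ j * digit t j + t.appr j := by
  have hp : 0 < p ^ j := pow_pos (Fact.out : p.Prime).pos j
  obtain ⟨c, hc⟩ := t.dvd_appr_sub_appr j (j + 1) j.le_succ
  have h : t.appr (j + 1) = p ^ j * c + t.appr j := by
    have := t.appr_mono j.le_succ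
    simp only [Nat.succ_eq_add_one] at this
    omega
  have hd : digit t j = c := by
    rw [digit, h, Nat.mul_add_div hp, Nat.div_eq_of_lt (t.appr_lt j), add_zero]
  rw [hd, h]

theorem digit_lt (t : ℤ_[p]) (j : ℕ) : digit t j < p := by
  rw [digit]
  apply Nat.div_lt_of_lt_mul
  rw [← pow_succ]
  exact t.appr_lt _

theorem eq_of_digit_eq {t u : ℤ_[p]} (h : ∀ j, digit t j = digit u j) : t = u := by
  have ha : ∀ n, t.appr n = u.appr n := by
    intro n
    induction n with
    | zero =>
      have h1 := t.appr_lt 0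
      have h2 := u.appr_lt 0
      rw [pow_zero] at h1 h2
      omega
    | succ n ih => rw [appr_succ, appr_succ, h, ih]
  refine PadicInt.ext_of_toZModPow.1 fun n => ?_
  exact congrArg (Nat.cast : ℕ → ZMod (p ^ n)) (ha n)

theorem exists_digit_eq (d : ℕ → ℕ) (hd : ∀ j, d j < p) : ∃ t : ℤ_[p], ∀ j, digit t j = d j := by
  let f : ℕ → ℕ := fun n => ∑ j ∈ Finset.range n, d j * p ^ j
  have hf : ∀ n, f n < p ^ n := by
    intro n
    induction n with
    | zero => simp [f]
    | succ n ih =>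
      have h1 : f (n + 1) = f n + d n * p ^ n := Finset.sum_range_succ _ _
      have h2 : (d n + 1) * p ^ n ≤ p * p ^ n := Nat.mul_le_mul_right _ (hd n)
      rw [h1, pow_succ', ← Nat.succ_le_iff]
      rw [add_mul, one_mul] at h2
      omega
  have hc : ∀ i, (p : ℤ) ^ i ∣ (f (i + 1) : ℤ) - f i := fun i => by
    simp [f, Finset.sum_range_succ]
  refine ⟨PadicInt.ofIntSeq _
    (PadicInt.isCauSeq_padicNorm_of_pow_dvd_sub (fun n => (f n : ℤ)) p hc), fun j => ?_⟩
  have ha := PadicInt.toZModPow_ofIntSeq_of_pow_dvd_sub (fun n => (f n : ℤ)) p hc (j + 1)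
  generalize PadicInt.ofIntSeq _
    (PadicInt.isCauSeq_padicNorm_of_pow_dvd_sub (fun n => (f n : ℤ)) p hc) = t at ha ⊢
  change ((t.appr (j + 1) : ℕ) : ZMod (p ^ (j + 1))) = _ at ha
  rw [Int.cast_natCast, ZMod.natCast_eq_natCast_iff', Nat.mod_eq_of_lt (t.appr_lt _),
    Nat.mod_eq_of_lt (hf _)] at ha
  have h1 : f (j + 1) = p ^ j * d j + f j := by
    simp only [f, Finset.sum_range_succ]
    ring
  rw [digit, ha, h1, Nat.mul_add_div (pow_pos (Fact.out : p.Prime).pos j),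
    Nat.div_eq_of_lt (hf j), add_zero]

theorem toZMod_eq_digit (t : ℤ_[p]) : PadicInt.toZMod t = (digit t 0 : ZMod p) := by
  have h := t.appr_spec 1
  rw [pow_one, ← PadicInt.maximalIdeal_eq_span_p, ← PadicInt.ker_toZMod, RingHom.mem_ker, map_sub,
    map_natCast, sub_eq_zero] at h
  rw [h, digit, pow_zero, Nat.div_one]

end Digits

section Series

open PowerSeries

variable {k : Type*} [CommRing k] {p : ℕ} [Fact p.Prime]

theorem coeff_mul_one_add_X_pow (f : k⟦X⟧) (q n : ℕ) :
    coeff (q + n) (f * (1 + X ^ q)) = coeff (q + n) f + coeff n f := by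
  rw [mul_add, mul_one, map_add, coeff_mul_X_pow', if_pos (by omega), Nat.add_sub_cancel_left]

/-- The partial product over `j < s` has degree at most `∑_{j < s} t_j p^j < p^s`. -/
theorem coeff_prod_eq_zero (t : ℤ_[p]) (s : ℕ) : ∀ n, p ^ s ≤ n →
    coeff n (∏ j ∈ Finset.range s, (1 + (X : k⟦X⟧) ^ p ^ j) ^ digit t j) = 0 := by
  induction s with
  | zero =>
    intro n hn
    rw [pow_zero] at hn
    simp [coeff_one, show n ≠ 0 by omega]
  | succ s ih =>
    have key : ∀ d n, (d + 1) * p ^ s ≤ n → coeff n ((∏ j ∈ Finset.range s,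
        (1 + (X : k⟦X⟧) ^ p ^ j) ^ digit t j) * (1 + X ^ p ^ s) ^ d) = 0 := by
      intro d
      induction d with
      | zero =>
        intro n hn
        rw [pow_zero, mul_one]
        exact ih n (by simpa using hn)
      | succ d ihd =>
        intro n hn
        rw [add_mul, one_mul] at hn
        obtain ⟨m, rfl⟩ : ∃ m, n = p ^ s + m := ⟨n - p ^ s, by omega⟩
        rw [pow_succ, ← mul_assoc, coeff_mul_one_add_X_pow, ihd _ (by omega), ihd _ (by omega),
          add_zero]
    intro n hn
    rw [Finset.prod_range_succ]
    refine key _ n (le_trans ?_ hn)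
    rw [pow_succ']
    exact Nat.mul_le_mul_right _ (digit_lt t s)

/-- The digits of `t` can be read off the series `(1 + z)^t`. -/
theorem coeff_pow_onePlusPow (t : ℤ_[p]) (s : ℕ) :
    coeff (p ^ s) (onePlusPow k t) = (digit t s : k) := by
  have hp := (Fact.out : p.Prime)
  have hs : s < p ^ s := Nat.lt_pow_self hp.one_lt
  rw [coeff_onePlusPow k t (p ^ s) (p ^ s + 1) le_rfl]
  have key : ∀ d : ℕ, coeff (p ^ s) ((∏ j ∈ Finset.range s,
      (1 + (X : k⟦X⟧) ^ p ^ j) ^ digit t j) * (1 + X ^ p ^ s) ^ d) = (d : k) := by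
    intro d
    induction d with
    | zero => rw [pow_zero, mul_one, coeff_prod_eq_zero t s _ le_rfl, Nat.cast_zero]
    | succ d ih =>
      have h := coeff_mul_one_add_X_pow ((∏ j ∈ Finset.range s,
        (1 + (X : k⟦X⟧) ^ p ^ j) ^ digit t j) * (1 + X ^ p ^ s) ^ d) (p ^ s) 0
      have h0 : (0 : k) ^ p ^ s = 0 := zero_pow (pow_pos hp.pos s).ne'
      rw [add_zero, ih, mul_assoc, ← pow_succ] at h
      rw [h, Nat.cast_succ, coeff_zero_eq_constantCoeff_apply, map_mul, map_prod]
      simp [zero_pow (pow_pos hp.pos _).ne']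
  have stable : ∀ N, s + 1 ≤ N → coeff (p ^ s) (∏ j ∈ Finset.range N,
      (1 + (X : k⟦X⟧) ^ p ^ j) ^ digit t j) = (digit t s : k) := by
    intro N hN
    induction N, hN using Nat.le_induction with
    | base => rw [Finset.prod_range_succ, key]
    | succ N hN ih =>
      have hlt : p ^ s < p ^ N := Nat.pow_lt_pow_right hp.one_lt hN
      obtain ⟨g, hg⟩ : (X : k⟦X⟧) ^ p ^ N ∣ (1 + X ^ p ^ N) ^ digit t N - 1 := by
        simpa using sub_one_dvd_pow_sub_one (1 + (X : k⟦X⟧) ^ p ^ N) (digit t N)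
      rw [Finset.prod_range_succ, sub_eq_iff_eq_add.mp hg, mul_add, mul_one, map_add,
        mul_left_comm, coeff_X_pow_mul', if_neg (by omega), zero_add, ih]
  exact stable _ (by omega)

theorem onePlusPow_injective [CharP k p] : Function.Injective (onePlusPow k (p := p)) := by
  intro t u h
  refine eq_of_digit_eq fun j => ?_
  have h1 := congrArg (coeff (p ^ j)) h
  rw [coeff_pow_onePlusPow, coeff_pow_onePlusPow] at h1
  exact CharP.natCast_injOn_Iio k p (digit_lt t j) (digit_lt u j) h1

end Series

section Recursion

open PowerSeries

variable {k : Type*} [Field k] {p : ℕ} [Fact p.Prime] [CharP k p]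

/-- The recursion up to `n = p - 1` gives `∏_{i < p} (a q - i) = p! a (q p) = 0`. -/
theorem exists_natCast_eq_of_recursion {a : ℕ → k} {q : ℕ} (ha : a 0 = 1)
    (h : ∀ n : ℕ, (n + 1) * a (q * (n + 1)) = (a q - n) * a (q * n)) :
    ∃ N < p, a q = (N : k) := by
  have key : ∀ r : ℕ, (r.factorial : k) * a (q * r) = ∏ i ∈ Finset.range r, (a q - i) := by
    intro r
    induction r with
    | zero => simp [ha]
    | succ r ih =>
      rw [Finset.prod_range_succ, ← ih, Nat.factorial_succ]
      push_cast
      linear_combination (r.factorial : k) * h r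
  have hp := key p
  rw [(CharP.cast_eq_zero_iff k p _).2 ((Fact.out : p.Prime).dvd_factorial.2 le_rfl), zero_mul]
    at hp
  obtain ⟨i, hi, h0⟩ := Finset.prod_eq_zero_iff.1 hp.symm
  exact ⟨i, Finset.mem_range.1 hi, sub_eq_zero.1 h0⟩

omit [Fact p.Prime] in
/-- Between consecutive multiples of `p` the recursion is the one of binomial coefficients; it can
be solved there because its leading coefficients are invertible. -/
theorem eq_choose_mul {a : ℕ → k} {q N : ℕ} (hN : a q = N)
    (h : ∀ n : ℕ, (n + 1) * a (q * (n + 1)) = (a q - n) * a (q * n)) (m : ℕ) :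
    ∀ r < p, a (q * (p * m + r)) = N.choose r * a (q * (p * m)) := by
  intro r
  induction r with
  | zero => intro; simp
  | succ r ih =>
    intro hr
    have h1 := h (p * m + r)
    rw [ih (by omega), hN] at h1
    have h2 : ((r + 1 : ℕ) : k) ≠ 0 := by
      rw [Ne, CharP.cast_eq_zero_iff k p]
      exact Nat.not_dvd_of_pos_of_lt r.succ_pos hr
    have h3 : ((r + 1 : ℕ) : k) * N.choose (r + 1) = (N - r) * N.choose r := by
      by_cases hrN : r ≤ N
      · have := congrArg (Nat.cast : ℕ → k) (Nat.choose_succ_right_eq N r)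
        push_cast [hrN] at this ⊢
        linear_combination this
      · rw [Nat.choose_eq_zero_of_lt (by omega), Nat.choose_eq_zero_of_lt (by omega)]
        simp
    push_cast at h1 h2 h3
    rw [CharP.cast_eq_zero k p] at h1
    apply mul_left_cancel₀ h2
    rw [← add_assoc]
    linear_combination h1 - a (q * (p * m)) * h3

/-- A sequence with the recursions of the binomial coefficients at all scales `p ^ s` is the
coefficient sequence of a `p`-adic binomial series. -/
theorem mk_eq_onePlusPow {a : ℕ → k} (ha : a 0 = 1)
    (h : ∀ s n : ℕ, (n + 1) * a (p ^ s * (n + 1)) = (a (p ^ s) - n) * a (p ^ s * n)) :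
    ∃ t : ℤ_[p], PowerSeries.mk a = onePlusPow k t := by
  have hp := (Fact.out : p.Prime)
  choose d hdp hd using fun s => exists_natCast_eq_of_recursion (p := p) ha (h s)
  obtain ⟨t, ht⟩ := exists_digit_eq d hdp
  refine ⟨t, ?_⟩
  -- The terms whose exponents are divisible by `p ^ s`. Splitting the exponent
  -- `p ^ s * (p * m + r)` with `r < p` gives the factorization `hF`.
  let F : ℕ → k⟦X⟧ := fun s => PowerSeries.mk fun n => if p ^ s ∣ n then a n else 0
  have hF : ∀ s, F s = (1 + X ^ p ^ s) ^ d s * F (s + 1) := by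
    intro s
    have hq : 0 < p ^ s := pow_pos hp.pos s
    ext n
    have h1 : ((1 : k⟦X⟧) + X ^ p ^ s) ^ d s * F (s + 1) =
        ∑ r ∈ Finset.range (d s + 1), X ^ (p ^ s * r) * (C ((d s).choose r : k) * F (s + 1)) := by
      rw [add_comm, add_pow, Finset.sum_mul]
      refine Finset.sum_congr rfl fun r _ => ?_
      rw [one_pow, mul_one, ← pow_mul, map_natCast, mul_assoc]
    rw [h1, map_sum]
    simp only [coeff_X_pow_mul', coeff_C_mul]
    by_cases hn : p ^ s ∣ n
    · obtain ⟨m, rfl⟩ := hn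
      have hm : p * (m / p) + m % p = m := Nat.div_add_mod m p
      have hlt : m % p < p := Nat.mod_lt _ hp.pos
      have h2 : coeff (p ^ s * m) (F s) = (d s).choose (m % p) * a (p ^ s * (p * (m / p))) := by
        simp only [F, coeff_mk, dvd_mul_right, if_true]
        rw [← eq_choose_mul (hd s) (h s) (m / p) _ hlt, hm]
      have h3 : ∀ r ∈ Finset.range (d s + 1), r ≠ m % p →
          (if p ^ s * r ≤ p ^ s * m then
            ((d s).choose r : k) * coeff (p ^ s * m - p ^ s * r) (F (s + 1)) else 0) = 0 := by
        intro r hr hrm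
        split_ifs with hle
        · have hle' : r ≤ m := Nat.le_of_mul_le_mul_left hle hq
          have hnd : ¬ p ^ (s + 1) ∣ p ^ s * m - p ^ s * r := by
            rw [← Nat.mul_sub, pow_succ, Nat.mul_dvd_mul_iff_left hq]
            intro hdvd
            have hr' : r < p := lt_of_lt_of_le (Finset.mem_range.1 hr) (hdp s)
            have := (Nat.modEq_iff_dvd' hle').2 hdvd
            rw [Nat.ModEq, Nat.mod_eq_of_lt hr'] at this
            exact hrm this
          simp only [F, coeff_mk, if_neg hnd, mul_zero]
        · rfl
      rw [h2]
      by_cases hmem : m % p ∈ Finset.range (d s + 1)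
      · have hle : p ^ s * (m % p) ≤ p ^ s * m := Nat.mul_le_mul_left _ (Nat.mod_le _ _)
        have hsub : p ^ s * m - p ^ s * (m % p) = p ^ s * (p * (m / p)) := by
          rw [← Nat.mul_sub]
          congr 1
          omega
        rw [Finset.sum_eq_single_of_mem _ hmem h3, if_pos hle, hsub]
        have hdvd : p ^ (s + 1) ∣ p ^ s * (p * (m / p)) := by
          rw [← mul_assoc, ← pow_succ]
          exact dvd_mul_right _ _
        simp only [F, coeff_mk, if_pos hdvd]
      · rw [Nat.choose_eq_zero_of_lt (by simpa using hmem), Nat.cast_zero, zero_mul]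
        exact (Finset.sum_eq_zero fun r hr => h3 r hr fun e => hmem (e ▸ hr)).symm
    · simp only [F, coeff_mk, if_neg hn]
      refine (Finset.sum_eq_zero fun r _ => ?_).symm
      split_ifs with hle hdvd
      · exact absurd ((Nat.dvd_sub_iff_left hle (dvd_mul_right _ _)).1
          ((pow_dvd_pow p s.le_succ).trans hdvd)) hn
      · exact mul_zero _
      · rfl
  have hF0 : PowerSeries.mk a = F 0 := by
    ext n
    simp [F]
  have hprod : ∀ N, F 0 = (∏ j ∈ Finset.range N, (1 + (X : k⟦X⟧) ^ p ^ j) ^ digit t j) * F N := by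
    intro N
    induction N with
    | zero => simp
    | succ N ih => rw [ih, Finset.prod_range_succ, mul_assoc, ht, ← hF]
  ext n
  have hlt : n < p ^ (n + 1) :=
    lt_of_lt_of_le n.lt_succ_self (Nat.lt_pow_self hp.one_lt).le
  rw [coeff_onePlusPow k t n (n + 1) le_rfl, hF0, hprod (n + 1), coeff_mul,
    Finset.sum_eq_single_of_mem (n, 0) (by simp)]
  · simp [F, ha]
  · rintro ⟨i, j⟩ hij hne
    rw [Finset.HasAntidiagonal.mem_antidiagonal] at hij
    have hj : j ≠ 0 := by
      rintro rfl
      exact hne (Prod.ext hij rfl)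
    have hnd : ¬ p ^ (n + 1) ∣ j := Nat.not_dvd_of_pos_of_lt (Nat.pos_of_ne_zero hj) (by
      simp only at hij
      omega)
    simp only [F, coeff_mk, if_neg hnd, mul_zero]

/-- A consequence of the theorem of Lucas. -/
theorem choose_prime_pow_mul (s n : ℕ) : ((p ^ s * (n + 1)).choose (p ^ s * n) : k) = n + 1 := by
  have hp := (Fact.out : p.Prime)
  induction s with
  | zero => simp
  | succ s ih =>
    rw [← ih, CharP.natCast_eq_natCast (R := k) p, pow_succ', mul_assoc, mul_assoc]
    have h := Choose.choose_modEq_choose_mod_mul_choose_div_nat (n := p * (p ^ s * (n + 1)))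
      (k := p * (p ^ s * n)) (p := p)
    simpa [Nat.mul_div_cancel_left _ hp.pos] using h

/-- The relations between `a` and `ψ`, evaluated at `(r, i) = (p ^ s, p ^ s * n)` in characteristic
`p`. The generating function of `ψ · i` is that of `a` divided by `(1 - e z) ^ i`. -/
theorem succ_mul_apply_prime_pow_mul {a : ℕ → k} {ψ : ℕ → ℕ → k} {e : k} (he : e * e = 1)
    (h0 : ∀ r, ψ r 0 = a r) (h1 : ∀ i, ψ 0 i = 1)
    (h2 : ∀ r i, ψ (r + 1) (i + 1) = ψ (r + 1) i + e * ψ r (i + 1))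
    (h3 : ∀ r i, ((r + i).choose i : k) * a (r + i) = ψ r i * a i) (s n : ℕ) :
    (n + 1) * a (p ^ s * (n + 1)) = (a (p ^ s) + n * e) * a (p ^ s * n) := by
  have hp := (Fact.out : p.Prime)
  have : CharP k⟦X⟧ p := charP_of_injective_ringHom (f := (C : k →+* k⟦X⟧)) C_injective p
  set q := p ^ s with hq
  have heq : e ^ q = e := by
    rcases mul_self_eq_one_iff.1 he with rfl | rfl
    · exact one_pow q
    · exact neg_one_pow_char_pow ..
  -- The generating function of `ψ · i`.
  let F : ℕ → k⟦X⟧ := fun i => PowerSeries.mk fun r => ψ r i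
  have hF : ∀ i, F (i + 1) * (1 - C e * X) = F i := by
    intro i
    ext r
    cases r with
    | zero => simp [F, mul_sub, h1]
    | succ r =>
      rw [mul_sub, mul_one, map_sub, mul_left_comm, coeff_C_mul, coeff_succ_mul_X]
      simp only [F, coeff_mk, h2]
      ring
  have hFm : ∀ m i, F (i + m) * (1 - C e * X) ^ m = F i := by
    intro m
    induction m with
    | zero => simp
    | succ m ih =>
      intro i
      rw [pow_succ', ← mul_assoc, ← add_assoc, hF, ih]
  have hfrob : ((1 : k⟦X⟧) - C e * X) ^ q = 1 - C e * X ^ q := by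
    rw [hq, sub_pow_char_pow, one_pow, mul_pow, ← map_pow, ← hq, heq]
  have hc : ∀ j : ℕ, coeff 0 (F (q * n) * (1 - C e * X ^ q) ^ j) = 1 ∧
      coeff q (F (q * n) * (1 - C e * X ^ q) ^ j) = ψ q (q * n) - j * e := by
    have hq0 : q ≠ 0 := (pow_pos hp.pos s).ne'
    intro j
    induction j with
    | zero => simp [F, h1]
    | succ j ih =>
      rw [pow_succ, ← mul_assoc, mul_sub, mul_one, map_sub, map_sub, mul_left_comm, coeff_C_mul,
        coeff_C_mul, coeff_mul_X_pow', coeff_mul_X_pow', if_pos le_rfl, Nat.sub_self, ih.1, ih.2,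
        if_neg (by omega)]
      push_cast
      exact ⟨by ring, by ring⟩
  have hψ : ψ q (q * n) = a q + n * e := by
    have h4 := hFm (q * n) 0
    rw [zero_add, pow_mul, hfrob] at h4
    have h5 := (hc n).2
    rw [h4] at h5
    simp only [F, coeff_mk, h0] at h5
    rw [h5]
    ring
  have h6 := h3 q (q * n)
  rw [hψ, show q + q * n = q * (n + 1) by ring, choose_prime_pow_mul] at h6
  exact h6

theorem exists_rescale_eq_onePlusPow {a : ℕ → k} {ψ : ℕ → ℕ → k} {e : k} (he : e * e = 1)
    (h0 : ∀ r, ψ r 0 = a r) (h1 : ∀ i, ψ 0 i = 1)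
    (h2 : ∀ r i, ψ (r + 1) (i + 1) = ψ (r + 1) i + e * ψ r (i + 1))
    (h3 : ∀ r i, ((r + i).choose i : k) * a (r + i) = ψ r i * a i) :
    ∃ t : ℤ_[p], rescale (-e) (PowerSeries.mk a) = onePlusPow k t := by
  rw [rescale_mk]
  refine mk_eq_onePlusPow (by rw [pow_zero, one_mul, ← h0, h1]) fun s n => ?_
  have heq : (-e) ^ p ^ s = -e := by
    rcases mul_self_eq_one_iff.1 he with rfl | rfl
    · exact neg_one_pow_char_pow ..
    · rw [neg_neg, one_pow]
  rw [pow_mul, pow_mul, heq]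
  have h4 := succ_mul_apply_prime_pow_mul (p := p) he h0 h1 h2 h3 s n
  linear_combination (-e) ^ (n + 1) * h4 - (-e) ^ n * n * a (p ^ s * n) * he

end Recursion

/-! ### Existence, uniqueness and reduction modulo `p` -/

section Main

variable {k : Type*} [Field k] {C : Type*} [Category* C] [Abelian C]
    [Linear k C] [MonoidalCategory C] [MonoidalPreadditive C] [MonoidalLinear k C]
    [SymmetricCategory C] [RigidCategory C] [IsSymmetricTensorCategory k C]

variable {p : ℕ} [Fact p.Prime] [CharP k p]

theorem PowerSystem.exists_rescale_mk_catDim {X : C} (S : PowerSystem k X) :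
    ∃ t : ℤ_[p], PowerSeries.rescale (-S.sign) (PowerSeries.mk fun n => catDim k (S.P n)) =
      onePlusPow k t :=
  exists_rescale_eq_onePlusPow (ψ := S.ψ) S.sign_mul_self (fun r => by rw [ψ]) S.ψ_zero_left
    (fun r i => by rw [ψ]) S.choose_mul_catDim_eq

variable (k)

theorem catDim_Q_one {X : C} (F : KernelFamily k X) :
    catDim k (F.Q 1 : C) = catDim k X :=
  catDim_congr k (@asIso _ _ _ _ _ F.isIso_arrow_one ≪≫ λ_ X)

theorem existsUnique_isDMinus (X : C) : ∃! d : ℤ_[p], IsDMinus k X d := by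
  obtain ⟨t, ht⟩ := (extFamily k X).toPowerSystem.exists_rescale_mk_catDim (p := p)
  have h1 : -(extFamily k X).toPowerSystem.sign = 1 := neg_neg 1
  rw [h1, PowerSeries.rescale_one, RingHom.id_apply] at ht
  exact ⟨t, ht, fun u hu => onePlusPow_injective (hu.symm.trans ht)⟩

theorem rescale_neg_one_rescale_neg_one (f : PowerSeries k) :
    PowerSeries.rescale (-1) (PowerSeries.rescale (-1) f) = f := by
  rw [PowerSeries.rescale_rescale]
  simp

theorem existsUnique_isDPlus (X : C) : ∃! d : ℤ_[p], IsDPlus k X d := by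
  obtain ⟨t, ht⟩ := (symFamily k X).toPowerSystem.exists_rescale_mk_catDim (p := p)
  have h1 : -(symFamily k X).toPowerSystem.sign = -1 := rfl
  rw [h1] at ht
  refine ⟨-t, ?_, fun u hu => ?_⟩
  · change PowerSeries.mk (fun n => catDim k ((symFamily k X).toPowerSystem.P n)) = _
    rw [oneSubPow, neg_neg, ← ht, rescale_neg_one_rescale_neg_one]
  · have hu' : PowerSeries.mk (fun n => catDim k ((symFamily k X).toPowerSystem.P n)) =
      oneSubPow k (-u) := hu
    rw [hu', oneSubPow, rescale_neg_one_rescale_neg_one] at ht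
    rw [← onePlusPow_injective ht, neg_neg]

theorem coeff_one_onePlusPow (t : ℤ_[p]) : PowerSeries.coeff 1 (onePlusPow k t) =
    ZMod.castHom (dvd_refl p) k (PadicInt.toZMod t) := by
  have h := coeff_pow_onePlusPow (k := k) t 0
  rw [pow_zero] at h
  rw [h, toZMod_eq_digit, map_natCast]

variable {k}

theorem IsDMinus.toZMod_eq {X : C} {d : ℤ_[p]} (h : IsDMinus k X d) :
    ZMod.castHom (dvd_refl p) k (PadicInt.toZMod d) = catDim k X := by
  rw [← coeff_one_onePlusPow, ← show PowerSeries.mk _ = onePlusPow k d from h,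
    PowerSeries.coeff_mk]
  exact catDim_Q_one k (extFamily k X)

theorem IsDPlus.toZMod_eq {X : C} {d : ℤ_[p]} (h : IsDPlus k X d) :
    ZMod.castHom (dvd_refl p) k (PadicInt.toZMod d) = catDim k X := by
  have h1 := congrArg (PowerSeries.coeff 1) (show PowerSeries.mk _ = oneSubPow k (-d) from h)
  rw [PowerSeries.coeff_mk, oneSubPow, PowerSeries.coeff_rescale, coeff_one_onePlusPow, map_neg,
    map_neg, pow_one, neg_one_mul, neg_neg] at h1
  rw [← h1]
  exact catDim_Q_one k (symFamily k X)

end Main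

end PadicDimension

end


theorem theorem2p3 {k : Type*} [Field k] [IsAlgClosed k] (p : ℕ) [Fact p.Prime] [CharP k p]
    {C : Type*} [Category* C] [Abelian C] [Linear k C] [MonoidalCategory C]
    [MonoidalPreadditive C] [MonoidalLinear k C] [SymmetricCategory C] [RigidCategory C]
    [PadicDimension.IsSymmetricTensorCategory k C] (X : C) :
    (∃! d : ℤ_[p], PadicDimension.IsDPlus k X d) ∧
    (∃! d : ℤ_[p], PadicDimension.IsDMinus k X d) ∧
    (∃! D : ℤ_[p], PadicDimension.IsSymPadicDim k X D) ∧
    (∃! D : ℤ_[p], PadicDimension.IsExtPadicDim k X D) ∧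
    (∀ D : ℤ_[p], PadicDimension.IsSymPadicDim k X D →
      ZMod.castHom (dvd_refl p) k (PadicInt.toZMod D) = PadicDimension.catDim k X) ∧
    (∀ D : ℤ_[p], PadicDimension.IsExtPadicDim k X D →
      ZMod.castHom (dvd_refl p) k (PadicInt.toZMod D) = PadicDimension.catDim k X) :=
  ⟨PadicDimension.existsUnique_isDPlus k X, PadicDimension.existsUnique_isDMinus k X,
    PadicDimension.existsUnique_isDPlus k _, PadicDimension.existsUnique_isDMinus k _,
    fun _ h => (PadicDimension.IsDPlus.toZMod_eq h).trans
      (PadicDimension.catDim_rightDual k X),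
    fun _ h => (PadicDimension.IsDMinus.toZMod_eq h).trans
      (PadicDimension.catDim_rightDual k X)⟩
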